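/- **Theorem (Convergence of A-SPDHG).** Let $X$ and $Y_1,\dots,Y_n$ be separable real Hilbert spaces, $Y=Y_1\times\dots\times Y_n$, let $A_i:X\to Y_i$ be bounded linear operators, and let $f_i:Y_i\to\mathbb R\cup\{+\infty\}$ and $g:X\to\mathbb R\cup\{+\infty\}$ be proper, convex and lower semi-continuous. Let $f_i^*(v)=\sup_u\langle u,v\rangle-f_i(u)$ be the Fenchel conjugate, $\operatorname{prox}_{th}(z)=\operatorname{argmin}_u\, h(u)+\frac1{2t}\|u-z\|^2$ for $t>0$, and $$L(x,y)=\sum_{i=1}^n\big(\langle A_ix,y_i\rangle-f_i^*(y_i)\big)+g(x).$$ Let $\mathcal C$ be the set of saddle points, i.e. of the $(x^*,y^*)\in X\times Y$ with $L(x^*,y)\le L(x^*,y^*)\le L(x,y^*)$ for all $x\in X$, $y\in Y$. Assume that $\mathcal C$ is non-empty and that $p_i>0$ for all $i\in\{1,\dots,n\}$, $\sum_i p_i=1$. On a probability space, let $I^0,I^1,\dots$ be independent random indices with $\mathbb P(I^k=i)=p_i$, and let $(\tau^k)_{k\in\mathbb N}$ and $(\sigma_i^k)_{k\in\mathbb N}$,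 $1\le i\le n$, be sequences of positive random step-sizes. Given $x^0\in X$, $y^0\in Y$ and $\bar y^0=y^0$, define for $k\in\mathbb N$ $$x^{k+1}=\operatorname{prox}_{\tau^{k+1}g}\Big(x^k-\tau^{k+1}\sum_{j=1}^nA_j^*\bar y_j^k\Big),$$ and, with $i=I^k$, $$y_i^{k+1}=\operatorname{prox}_{\sigma_i^{k+1}f_i^*}\big(y_i^k+\sigma_i^{k+1}A_ix^{k+1}\big),\qquad \bar y_i^{k+1}=y_i^{k+1}+\tfrac1{p_i}(y_i^{k+1}-y_i^k),\qquad y_j^{k+1}=\bar y_j^{k+1}=y_j^k\ \ (j\ne i).$$ Let $\mathcal F^k$ be the $\sigma$-algebra generated by $(x^l,y^l)$, $0\le l\le k$. Assume: 1. for all $k\in\mathbb N$ and $i$, $\tau^{k+1}$ and $\sigma_i^{k+1}$ are $\mathcal F^k$-measurable; 2. there is $\beta\in(0,1)$ such that, almost surely, $\tau^k\sigma_i^k\|A_i\|^2/p_i\le\beta$ for all $i$ and all $k\in\mathbb N$; 3. each of the sequences $(\tau^k)_k$ and $(\sigma_i^k)_k$, $1\le i\le n$, is uniformly almost surely quasi-increasing: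 for each such sequence $(u^k)_k$ there is a deterministic sequence $(\eta^k)_{k\in\mathbb N}$ in $[0,1)$ with $\sum_k\eta^k<\infty$ such that, almost surely, $u^{k+1}\ge(1-\eta^k)u^k$ for all $k\in\mathbb N$. Then there is a random variable $(\hat x,\hat y)$ with values in $X\times Y$ such that, almost surely, $(\hat x,\hat y)\in\mathcal C$ and $(x^k,y^k)_{k\in\mathbb N}$ converges weakly to $(\hat x,\hat y)$. -/

import Mathlib

open MeasureTheory ProbabilityTheory Filter Topology
open scoped InnerProductSpace

namespace ASPDHG

section Convex

variable {H : Type*} [NormedAddCommGroup H] [InnerProductSpace ℝ H]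

/-- `h : H → ℝ ∪ {+∞}` is proper, convex and lower semi-continuous. Extended-real-valued functions
are coded with values in `EReal`; the value `-∞` is excluded by `ne_bot`. -/
structure IsProperConvexLSC (h : H → EReal) : Prop where
  ne_bot : ∀ u, h u ≠ ⊥
  exists_ne_top : ∃ u, h u ≠ ⊤
  convex : ∀ u v : H, ∀ a b : ℝ, 0 ≤ a → 0 ≤ b → a + b = 1 →
    h (a • u + b • v) ≤ (a : EReal) * h u + (b : EReal) * h v
  lsc : LowerSemicontinuous h

/-- The Fenchel conjugate `h^*(v) = sup_u ⟨u, v⟩ - h(u)`. -/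
noncomputable def conj (h : H → EReal) (v : H) : EReal :=
  ⨆ u : H, ((⟪u, v⟫_ℝ : ℝ) : EReal) - h u

/-- `prox_{t h}(z)`, the minimizer of `u ↦ h(u) + ‖u - z‖² / (2 t)`. It exists and is unique if
`t > 0` and `h` is proper, convex and lower semi-continuous (otherwise the value is arbitrary). -/
noncomputable def prox (t : ℝ) (h : H → EReal) (z : H) : H :=
  Classical.epsilon fun q : H =>
    IsMinOn (fun u : H => h u + ((‖u - z‖ ^ 2 / (2 * t) : ℝ) : EReal)) Set.univ q

end Convex

section Algorithm

variable {n : ℕ} {X : Type*} {Y : Fin n → Type*}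
  [NormedAddCommGroup X] [InnerProductSpace ℝ X]
  [∀ i, NormedAddCommGroup (Y i)] [∀ i, InnerProductSpace ℝ (Y i)]

/-- The Lagrangian `L(x, y) = ∑ i, (⟨A_i x, y_i⟩ - f_i^*(y_i)) + g(x)`. Where the first term is `-∞`
and `g(x) = +∞`, the convention of `EReal` gives `L(x, y) = -∞`. -/
noncomputable def lagrangian (A : ∀ i, X →L[ℝ] Y i) (f : ∀ i, Y i → EReal) (g : X → EReal)
    (x : X) (y : ∀ i, Y i) : EReal :=
  (∑ i, (((⟪A i x, y i⟫_ℝ : ℝ) : EReal) - conj (f i) (y i))) + g x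

/-- The saddle points of `min_x sup_y L(x, y)`: the pairs `(x*, y*)` such that
`L(x*, y) ≤ L(x*, y*) ≤ L(x, y*)` for all `x` and `y`. -/
def saddlePoints (A : ∀ i, X →L[ℝ] Y i) (f : ∀ i, Y i → EReal) (g : X → EReal) :
    Set (X × ∀ i, Y i) :=
  {z | (∀ y, lagrangian A f g z.1 y ≤ lagrangian A f g z.1 z.2) ∧
    ∀ x, lagrangian A f g z.1 z.2 ≤ lagrangian A f g x z.2}

variable (X Y) in
/-- The variables `(x^k, y^k, ȳ^k)` carried by the algorithm. -/
structure State where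
  /-- the primal iterate -/
  x : X
  /-- the dual iterate -/
  y : ∀ i, Y i
  /-- the extrapolated dual iterate -/
  ybar : ∀ i, Y i

variable [CompleteSpace X] [∀ i, CompleteSpace (Y i)]

/-- One iteration of the algorithm, with primal step-size `t`, dual step-sizes `s`, and selected
index `i`. -/
noncomputable def step (A : ∀ i, X →L[ℝ] Y i) (f : ∀ i, Y i → EReal) (g : X → EReal)
    (p : Fin n → ℝ) (t : ℝ) (s : Fin n → ℝ) (i : Fin n) (S : State X Y) : State X Y :=
  let x' : X := prox t g (S.x - t • ∑ j, ContinuousLinearMap.adjoint (A j) (S.ybar j))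
  let y' : ∀ j, Y j := fun j =>
    if j = i then prox (s j) (conj (f j)) (S.y j + s j • A j x') else S.y j
  { x := x'
    y := y'
    ybar := fun j => if j = i then y' j + (1 / p j) • (y' j - S.y j) else S.y j }

/-- The states of the algorithm started at `(x0, y0)` with `ȳ^0 = y^0`. Iteration `k`, which leads
from state `k` to state `k + 1`, uses the step-sizes of index `k + 1` and the index `I k`. -/
noncomputable def run (A : ∀ i, X →L[ℝ] Y i) (f : ∀ i, Y i → EReal) (g : X → EReal)
    (p : Fin n → ℝ) (x0 : X) (y0 : ∀ i, Y i) (τ : ℕ → ℝ) (σ : Fin n → ℕ → ℝ) (I : ℕ → Fin n) :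
    ℕ → State X Y
  | 0 => { x := x0, y := y0, ybar := y0 }
  | k + 1 => step A f g p (τ (k + 1)) (fun i => σ i (k + 1)) (I k)
      (run A f g p x0 y0 τ σ I k)

/-- The random iterate `(x^k, y^k)`. -/
noncomputable def iterate {Ω : Type*} (A : ∀ i, X →L[ℝ] Y i) (f : ∀ i, Y i → EReal) (g : X → EReal)
    (p : Fin n → ℝ) (x0 : X) (y0 : ∀ i, Y i) (τ : ℕ → Ω → ℝ) (σ : Fin n → ℕ → Ω → ℝ)
    (I : ℕ → Ω → Fin n) (k : ℕ) (ω : Ω) : X × ∀ i, Y i :=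
  let S := run A f g p x0 y0 (fun l => τ l ω) (fun i l => σ i l ω) (fun l => I l ω) k
  (S.x, S.y)

end Algorithm

/-- The σ-algebra generated by `u^0, …, u^k`. -/
abbrev history {Ω E : Type*} [MeasurableSpace E] (u : ℕ → Ω → E) (k : ℕ) : MeasurableSpace Ω :=
  ⨆ l : Fin (k + 1), MeasurableSpace.comap (u l) inferInstance

/-- The random sequence `u` of positive reals is uniformly almost surely quasi-increasing: its
control `η` is deterministic. -/
def UniformlyQuasiIncreasing {Ω : Type*} [MeasurableSpace Ω] (μ : Measure Ω) (u : ℕ → Ω → ℝ) :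
    Prop :=
  (∀ k ω, 0 < u k ω) ∧
  ∃ η : ℕ → ℝ, (∀ k, 0 ≤ η k ∧ η k < 1) ∧ Summable η ∧
    ∀ᵐ ω ∂μ, ∀ k, (1 - η k) * u k ω ≤ u (k + 1) ω

end ASPDHG

/-! Relative to a fixed saddle point, the distance is measured by `lyap`: squared distances weighted
by inverse step-sizes (dual blocks also by `1 / p j`), corrected by a cross term and a quadratic
term in the extrapolation `ybar - y`. Saddle points are the solutions of two subgradient inclusions
(`mem_saddlePoints_iff`) and every proximal step produces a subgradient, so monotonicity of
subdifferentials controls the new distances. After averaging over the sampled block, at frozen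
step-sizes, `lyap` falls by at least `drift`, a multiple of the squared increments
(`sum_mul_lyap_step_le`). The step-size condition, with `κ = √β < 1`, absorbs the one cross term
that does not telescope. Moving to the next step-sizes costs only a factor `1 +` (summable)
(`lyap_le_mul_lyap`).

By Robbins-Siegmund (`ae_tendsto_and_summable_of_condExp_le`), almost surely `lyap` converges and
`drift` is summable. Along such a realization increments and extrapolations vanish, the weights have
positive limits, and the weighted distances to saddle points converge. Weak cluster points are
saddle points (`mem_saddlePoints_of_weak_limit`), and Opial's argument (`weak_limit_unique`) leaves
only one. Since the null set depends on the saddle point, the distances are followed only for a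
countable dense set of saddle points, and Opial's argument passes to its closure by continuity.

Two devices keep this rigorous. A block with `A i = 0` is not constrained by the step-size
condition, so its step-size may blow up; `effPrimal` and `effDual` replace such step-sizes by `1` in
the weights. And as the indices take finitely many values, the state at time `k` takes finitely many
values (`DependsOnPast`), so integrability is automatic and measurability of `prox` is never needed.
-/

namespace ASPDHG

/-! ### Convex analysis: conjugates, proximal points, weak lower semicontinuity. -/

section Convex

variable {H : Type*} [NormedAddCommGroup H] [InnerProductSpace ℝ H]

/-- `v` is a subgradient of `h` at `q`, a point where `h` is finite. -/
def IsSubgradient (h : H → EReal) (q v : H) : Prop :=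
  ∃ r : ℝ, h q = r ∧ ∀ u, ((r + ⟪v, u - q⟫_ℝ : ℝ) : EReal) ≤ h u

theorem IsSubgradient.monotone {h : H → EReal} {q v q' v' : H} (hq : IsSubgradient h q v)
    (hq' : IsSubgradient h q' v') : 0 ≤ ⟪v - v', q - q'⟫_ℝ := by
  obtain ⟨r, hr, h1⟩ := hq
  obtain ⟨r', hr', h2⟩ := hq'
  have h3 := h1 q'
  have h4 := h2 q
  rw [hr', EReal.coe_le_coe_iff] at h3
  rw [hr, EReal.coe_le_coe_iff] at h4
  rw [← neg_sub q q', inner_neg_right] at h3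
  rw [inner_sub_left]
  linarith

/-- The epigraph of an extended-real-valued function, as a set of pairs with real height. -/
def epigraph (h : H → EReal) : Set (H × ℝ) := {w | h w.1 ≤ (w.2 : EReal)}

theorem IsProperConvexLSC.exists_eq_coe {h : H → EReal} (hh : IsProperConvexLSC h) {u : H}
    (hu : h u ≠ ⊤) : ∃ r : ℝ, h u = r :=
  ⟨(h u).toReal, (EReal.coe_toReal hu (hh.ne_bot u)).symm⟩

theorem IsProperConvexLSC.convex_epigraph {h : H → EReal} (hh : IsProperConvexLSC h) :
    Convex ℝ (epigraph h) := by
  rintro ⟨u, r⟩ hu ⟨v, s⟩ hv a b ha hb hab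
  simp only [epigraph, Set.mem_ofPred_eq] at hu hv ⊢
  refine (hh.convex u v a b ha hb hab).trans ?_
  obtain ⟨r', hr'⟩ := hh.exists_eq_coe (ne_top_of_le_ne_top (EReal.coe_ne_top _) hu)
  obtain ⟨s', hs'⟩ := hh.exists_eq_coe (ne_top_of_le_ne_top (EReal.coe_ne_top _) hv)
  rw [hr', EReal.coe_le_coe_iff] at hu
  rw [hs', EReal.coe_le_coe_iff] at hv
  rw [hr', hs', ← EReal.coe_mul, ← EReal.coe_mul, ← EReal.coe_add, EReal.coe_le_coe_iff]
  simp only [Prod.snd_add, Prod.smul_snd, smul_eq_mul]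
  gcongr

theorem IsProperConvexLSC.isClosed_epigraph {h : H → EReal} (hh : IsProperConvexLSC h) :
    IsClosed (epigraph h) := by
  have := lowerSemicontinuous_iff_isClosed_epigraph.1 hh.lsc
  exact this.preimage (f := fun w : H × ℝ => (w.1, (w.2 : EReal)))
    (continuous_fst.prodMk (continuous_coe_real_ereal.comp continuous_snd))

/-- Hahn-Banach separation of the closed convex epigraph from a point just below it. -/
theorem IsProperConvexLSC.exists_affine_le [CompleteSpace H] {h : H → EReal}
    (hh : IsProperConvexLSC h) :
    ∃ (v : H) (c : ℝ), ∀ u, ((⟪u, v⟫_ℝ + c : ℝ) : EReal) ≤ h u := by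
  obtain ⟨u₀, hu₀⟩ := hh.exists_ne_top
  obtain ⟨r₀, hr₀⟩ := hh.exists_eq_coe hu₀
  have hnot : (u₀, r₀ - 1) ∉ epigraph h := by
    simp only [epigraph, Set.mem_ofPred_eq, hr₀, EReal.coe_le_coe_iff]
    linarith
  obtain ⟨φ, c, hφ, hc⟩ := geometric_hahn_banach_point_closed hh.convex_epigraph
    hh.isClosed_epigraph hnot
  have hsplit : ∀ u r, φ (u, r) = φ (u, 0) + r * φ (0, 1) := by
    intro u r
    have : ((u, r) : H × ℝ) = (u, 0) + r • ((0, 1) : H × ℝ) := by simp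
    rw [this, map_add, map_smul, smul_eq_mul]
  set a := φ (0, 1)
  -- The separated point lies vertically below a point of the epigraph, so the separating hyperplane
  -- is not vertical.
  have ha : 0 < a := by
    have h1 := hc (u₀, r₀) (by simp [epigraph, hr₀])
    rw [hsplit] at hφ h1
    nlinarith
  set v := (InnerProductSpace.toDual ℝ H).symm (φ.comp (ContinuousLinearMap.inl ℝ H ℝ))
  have hv : ∀ u, ⟪u, v⟫_ℝ = φ (u, 0) := by
    intro u
    rw [real_inner_comm, InnerProductSpace.toDual_symm_apply]
    simp
  refine ⟨-(a⁻¹ • v), c / a, fun u => ?_⟩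
  by_cases hu : h u = ⊤
  · simp [hu]
  obtain ⟨r, hr⟩ := hh.exists_eq_coe hu
  have h1 := hc (u, r) (by simp [epigraph, hr])
  rw [hsplit, ← hv] at h1
  rw [hr, EReal.coe_le_coe_iff, inner_neg_right, inner_smul_right, ← sub_nonneg]
  have : r - (-(a⁻¹ * ⟪u, v⟫_ℝ) + c / a) = (⟪u, v⟫_ℝ + r * a - c) / a := by
    field_simp
    ring
  rw [this]
  exact div_nonneg (by linarith) ha.le

theorem le_conj (h : H → EReal) (u v : H) : ((⟪u, v⟫_ℝ : ℝ) : EReal) - h u ≤ conj h v :=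
  le_iSup (fun u : H => ((⟪u, v⟫_ℝ : ℝ) : EReal) - h u) u

theorem conj_le_coe_iff {h : H → EReal} (hh : IsProperConvexLSC h) {v : H} {c : ℝ} :
    conj h v ≤ c ↔ ∀ u r, h u = ((r : ℝ) : EReal) → ⟪u, v⟫_ℝ - r ≤ c := by
  constructor
  · intro hc u r hr
    have h1 := (le_conj h u v).trans hc
    rwa [hr, ← EReal.coe_sub, EReal.coe_le_coe_iff] at h1
  · intro H
    refine iSup_le fun u => ?_
    by_cases hu : h u = ⊤
    · simp [hu]
    obtain ⟨r, hr⟩ := hh.exists_eq_coe hu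
    rw [hr, ← EReal.coe_sub, EReal.coe_le_coe_iff]
    exact H u r hr

theorem IsProperConvexLSC.conj [CompleteSpace H] {h : H → EReal} (hh : IsProperConvexLSC h) :
    IsProperConvexLSC (conj h) := by
  have hbot : ∀ v, ASPDHG.conj h v ≠ ⊥ := by
    intro v
    obtain ⟨u₀, hu₀⟩ := hh.exists_ne_top
    obtain ⟨r₀, hr₀⟩ := hh.exists_eq_coe hu₀
    refine ne_bot_of_le_ne_bot ?_ (le_conj h u₀ v)
    rw [hr₀, ← EReal.coe_sub]
    exact EReal.coe_ne_bot _
  refine ⟨hbot, ?_, ?_, ?_⟩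
  · obtain ⟨v, c, hv⟩ := hh.exists_affine_le
    refine ⟨v, ne_top_of_le_ne_top (EReal.coe_ne_top (-c)) ?_⟩
    rw [conj_le_coe_iff hh]
    intro u r hr
    have h1 := hv u
    rw [hr, EReal.coe_le_coe_iff] at h1
    linarith
  · intro u v a b ha hb hab
    rcases ha.eq_or_lt with rfl | ha
    · obtain rfl : b = 1 := by linarith
      simp
    rcases hb.eq_or_lt with rfl | hb
    · obtain rfl : a = 1 := by linarith
      simp
    by_cases hu : ASPDHG.conj h u = ⊤
    · rw [hu, EReal.coe_mul_top_of_pos ha, EReal.top_add_of_ne_bot]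
      · exact le_top
      · by_cases hv : ASPDHG.conj h v = ⊤
        · simp [hv, EReal.coe_mul_top_of_pos hb]
        · rw [← EReal.coe_toReal hv (hbot v), ← EReal.coe_mul]
          exact EReal.coe_ne_bot _
    by_cases hv : ASPDHG.conj h v = ⊤
    · rw [hv, EReal.coe_mul_top_of_pos hb, EReal.add_top_of_ne_bot]
      · exact le_top
      · rw [← EReal.coe_toReal hu (hbot u), ← EReal.coe_mul]
        exact EReal.coe_ne_bot _
    have hu' := EReal.coe_toReal hu (hbot u)
    have hv' := EReal.coe_toReal hv (hbot v)
    rw [← hu', ← hv', ← EReal.coe_mul, ← EReal.coe_mul, ← EReal.coe_add, conj_le_coe_iff hh]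
    intro w r hr
    have h1 := (conj_le_coe_iff hh).1 hu'.ge w r hr
    have h2 := (conj_le_coe_iff hh).1 hv'.ge w r hr
    rw [inner_add_right, inner_smul_right, inner_smul_right]
    have : r = a * r + b * r := by rw [← add_mul, hab, one_mul]
    nlinarith
  · refine lowerSemicontinuous_iSup fun u => ?_
    by_cases hu : h u = ⊤
    · simp only [hu, EReal.sub_top]
      exact lowerSemicontinuous_const
    obtain ⟨r, hr⟩ := hh.exists_eq_coe hu
    simp only [hr, ← EReal.coe_sub]
    exact (continuous_coe_real_ereal.comp (by fun_prop)).lowerSemicontinuous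

theorem IsProperConvexLSC.exists_isMinOn_prox [CompleteSpace H] {h : H → EReal}
    (hh : IsProperConvexLSC h) {t : ℝ} (ht : 0 < t) (z : H) :
    ∃ q, IsMinOn (fun u : H => h u + ((‖u - z‖ ^ 2 / (2 * t) : ℝ) : EReal)) Set.univ q := by
  -- Minimizing over the epigraph keeps the objective real-valued.
  set val : H × ℝ → ℝ := fun w => w.2 + ‖w.1 - z‖ ^ 2 / (2 * t) with hval
  obtain ⟨v, c, hv⟩ := hh.exists_affine_le
  have hbdd : BddBelow (val '' epigraph h) := by
    refine ⟨⟪z, v⟫_ℝ + c - t / 2 * ‖v‖ ^ 2, ?_⟩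
    rintro _ ⟨⟨u, r⟩, hu, rfl⟩
    have h1 := (hv u).trans hu
    rw [EReal.coe_le_coe_iff] at h1
    -- Completing the square: an affine minorant plus the quadratic term is bounded below.
    have h2 : 0 ≤ ‖(u - z) + t • v‖ ^ 2 / (2 * t) := by positivity
    rw [norm_add_sq_real, inner_smul_right, norm_smul, inner_sub_left, Real.norm_of_nonneg ht.le]
      at h2
    have h3 : (‖u - z‖ ^ 2 + 2 * (t * (⟪u, v⟫_ℝ - ⟪z, v⟫_ℝ)) + (t * ‖v‖) ^ 2) / (2 * t)
        = ‖u - z‖ ^ 2 / (2 * t) + (⟪u, v⟫_ℝ - ⟪z, v⟫_ℝ) + t / 2 * ‖v‖ ^ 2 := by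
      field_simp
    simp only [hval] at h1 ⊢
    linarith
  have hne : (val '' epigraph h).Nonempty := by
    obtain ⟨u₀, hu₀⟩ := hh.exists_ne_top
    obtain ⟨r₀, hr₀⟩ := hh.exists_eq_coe hu₀
    exact ⟨_, (u₀, r₀), by simp [epigraph, hr₀], rfl⟩
  set m := sInf (val '' epigraph h)
  have hm : ∀ w ∈ epigraph h, m ≤ val w := fun w hw => csInf_le hbdd ⟨w, hw, rfl⟩
  have hseq : ∀ k : ℕ, ∃ w ∈ epigraph h, val w < m + 1 / ((k : ℝ) + 1) := by
    intro k
    obtain ⟨_, ⟨w, hw, rfl⟩, hlt⟩ := exists_lt_of_csInf_lt hne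
      (show m < m + 1 / ((k : ℝ) + 1) by linarith [Nat.one_div_pos_of_nat (α := ℝ) (n := k)])
    exact ⟨w, hw, hlt⟩
  choose w hw hlt using hseq
  -- Strong convexity: by the parallelogram law, the midpoint of two distant near-minimizers would
  -- have a value below the infimum. Hence minimizing sequences are Cauchy.
  have hmid : ∀ k l, ‖(w k).1 - (w l).1‖ ^ 2 ≤ 4 * t * ((val (w k) - m) + (val (w l) - m)) := by
    intro k l
    have h1 := hm _ (hh.convex_epigraph (hw k) (hw l) (by norm_num : (0 : ℝ) ≤ 1 / 2)
      (by norm_num : (0 : ℝ) ≤ 1 / 2) (by norm_num))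
    have h2 := parallelogram_law_with_norm ℝ ((w k).1 - z) ((w l).1 - z)
    have h3 : (1 / 2 : ℝ) • (w k).1 + (1 / 2 : ℝ) • (w l).1 - z
        = (1 / 2 : ℝ) • (((w k).1 - z) + ((w l).1 - z)) := by
      module
    have h4 : (w k).1 - z - ((w l).1 - z) = (w k).1 - (w l).1 := by abel
    rw [h4] at h2
    simp only [hval, Prod.fst_add, Prod.smul_fst, Prod.snd_add, Prod.smul_snd, h3, norm_smul,
      smul_eq_mul] at h1 ⊢
    set N := ‖(w k).1 - z + ((w l).1 - z)‖
    set N' := ‖(w k).1 - (w l).1‖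
    set a := ‖(w k).1 - z‖
    set b := ‖(w l).1 - z‖
    have h5 : (‖(1 / 2 : ℝ)‖ * N) ^ 2 = (2 * (a ^ 2 + b ^ 2) - N' ^ 2) / 4 := by
      rw [Real.norm_of_nonneg (by norm_num)]
      linear_combination h2 / 4
    rw [h5] at h1
    have h6 : 4 * t * ((w k).2 + a ^ 2 / (2 * t) - m + ((w l).2 + b ^ 2 / (2 * t) - m)) - N' ^ 2
        = 8 * t * (1 / 2 * (w k).2 + 1 / 2 * (w l).2
          + (2 * (a ^ 2 + b ^ 2) - N' ^ 2) / 4 / (2 * t) - m) := by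
      field_simp
      ring
    have h7 : 0 ≤ 8 * t * (1 / 2 * (w k).2 + 1 / 2 * (w l).2
          + (2 * (a ^ 2 + b ^ 2) - N' ^ 2) / 4 / (2 * t) - m) :=
      mul_nonneg (by linarith) (by linarith)
    linarith
  have hvaltend : Tendsto (fun k => val (w k)) atTop (𝓝 m) := by
    refine tendsto_of_tendsto_of_tendsto_of_le_of_le tendsto_const_nhds ?_
      (fun k => hm _ (hw k)) (fun k => (hlt k).le)
    simpa using (tendsto_const_nhds (x := m)).add (tendsto_one_div_add_atTop_nhds_zero_nat (𝕜 := ℝ))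
  have hcauchy : CauchySeq fun k => (w k).1 := by
    rw [Metric.cauchySeq_iff']
    intro ε hε
    have hev : ∀ᶠ k in atTop, val (w k) < m + ε ^ 2 / (8 * t) :=
      hvaltend.eventually_lt_const (by linarith [show 0 < ε ^ 2 / (8 * t) by positivity])
    obtain ⟨N, hN⟩ := eventually_atTop.1 hev
    refine ⟨N, fun k hk => ?_⟩
    rw [dist_eq_norm]
    refine lt_of_pow_lt_pow_left₀ 2 hε.le ((hmid k N).trans_lt ?_)
    have h1 := hN k hk
    have h2 := hN N le_rfl
    calc 4 * t * ((val (w k) - m) + (val (w N) - m))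
        < 4 * t * (ε ^ 2 / (8 * t) + ε ^ 2 / (8 * t)) := by
          gcongr
          · linarith
          · linarith
      _ = ε ^ 2 := by field_simp; ring
  obtain ⟨q, hq⟩ := cauchySeq_tendsto_of_complete hcauchy
  have hr : Tendsto (fun k => (w k).2) atTop (𝓝 (m - ‖q - z‖ ^ 2 / (2 * t))) := by
    have h1 : Tendsto (fun k => val (w k) - ‖(w k).1 - z‖ ^ 2 / (2 * t)) atTop
        (𝓝 (m - ‖q - z‖ ^ 2 / (2 * t))) :=
      hvaltend.sub ((((hq.sub_const z).norm).pow 2).div_const _)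
    refine h1.congr fun k => ?_
    simp [hval]
  have hmem : (q, m - ‖q - z‖ ^ 2 / (2 * t)) ∈ epigraph h :=
    hh.isClosed_epigraph.mem_of_tendsto (hq.prodMk_nhds hr) (Eventually.of_forall hw)
  refine ⟨q, fun u _ => ?_⟩
  simp only [Set.mem_ofPred_eq]
  have hle : h q + ((‖q - z‖ ^ 2 / (2 * t) : ℝ) : EReal) ≤ (m : EReal) := by
    refine (add_le_add_left hmem _).trans ?_
    rw [← EReal.coe_add, EReal.coe_le_coe_iff]
    simp
  refine hle.trans ?_
  by_cases hu : h u = ⊤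
  · simp [hu]
  obtain ⟨r, hr⟩ := hh.exists_eq_coe hu
  rw [hr, ← EReal.coe_add, EReal.coe_le_coe_iff]
  exact hm (u, r) (by simp [epigraph, hr])

/-- The minimizer is compared with points of the segment towards `u`, at parameter `l`; after
division by `l`, the quadratic remainder vanishes as `l → 0`. -/
theorem IsProperConvexLSC.isSubgradient_prox [CompleteSpace H] {h : H → EReal}
    (hh : IsProperConvexLSC h) {t : ℝ} (ht : 0 < t) (z : H) :
    IsSubgradient h (prox t h z) (t⁻¹ • (z - prox t h z)) := by
  have hmin : IsMinOn (fun u : H => h u + ((‖u - z‖ ^ 2 / (2 * t) : ℝ) : EReal)) Set.univ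
    (prox t h z) := Classical.epsilon_spec (hh.exists_isMinOn_prox ht z)
  set q := prox t h z
  have hmin' : ∀ u, h q + ((‖q - z‖ ^ 2 / (2 * t) : ℝ) : EReal)
      ≤ h u + ((‖u - z‖ ^ 2 / (2 * t) : ℝ) : EReal) := fun u => hmin (Set.mem_univ u)
  have hq : h q ≠ ⊤ := by
    obtain ⟨u₀, hu₀⟩ := hh.exists_ne_top
    obtain ⟨r₀, hr₀⟩ := hh.exists_eq_coe hu₀
    intro htop
    have h1 := hmin' u₀
    rw [htop, hr₀, ← EReal.coe_add, EReal.top_add_coe, top_le_iff] at h1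
    exact EReal.coe_ne_top _ h1
  obtain ⟨r, hr⟩ := hh.exists_eq_coe hq
  refine ⟨r, hr, fun u => ?_⟩
  by_cases hu : h u = ⊤
  · simp [hu]
  obtain ⟨s, hs⟩ := hh.exists_eq_coe hu
  rw [hs, EReal.coe_le_coe_iff]
  have key : ∀ l ∈ Set.Ioc (0 : ℝ) 1,
      0 ≤ (s - r) + ⟪q - z, u - q⟫_ℝ / t + l * (‖u - q‖ ^ 2 / (2 * t)) := by
    intro l hl
    have h1 := (hmin' ((1 - l) • q + l • u)).trans
      (add_le_add_left (hh.convex q u (1 - l) l (by linarith [hl.2]) hl.1.le (by ring)) _)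
    rw [hr, hs, ← EReal.coe_mul, ← EReal.coe_mul, ← EReal.coe_add, ← EReal.coe_add,
      ← EReal.coe_add, EReal.coe_le_coe_iff] at h1
    have h2 : (1 - l) • q + l • u - z = (q - z) + l • (u - q) := by module
    rw [h2, norm_add_sq_real, inner_smul_right, norm_smul, Real.norm_of_nonneg hl.1.le] at h1
    have h3 : (s - r) + ⟪q - z, u - q⟫_ℝ / t + l * (‖u - q‖ ^ 2 / (2 * t))
      = ((1 - l) * r + l * s + (‖q - z‖ ^ 2 + 2 * (l * ⟪q - z, u - q⟫_ℝ) + (l * ‖u - q‖) ^ 2)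
        / (2 * t) - (r + ‖q - z‖ ^ 2 / (2 * t))) / l := by
      have := hl.1.ne'
      field_simp
      ring
    rw [h3]
    exact div_nonneg (by linarith) hl.1.le
  have hlim : Tendsto (fun l : ℝ => (s - r) + ⟪q - z, u - q⟫_ℝ / t + l * (‖u - q‖ ^ 2 / (2 * t)))
      (𝓝[>] 0) (𝓝 ((s - r) + ⟪q - z, u - q⟫_ℝ / t + 0 * (‖u - q‖ ^ 2 / (2 * t)))) :=
    (tendsto_nhdsWithin_of_tendsto_nhds (by
      exact (continuous_const.add (continuous_id.mul continuous_const)).tendsto 0))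
  have h0 := ge_of_tendsto hlim
    (eventually_of_mem (Ioc_mem_nhdsGT (zero_lt_one' ℝ)) key)
  rw [inner_smul_left, ← neg_sub q z, inner_neg_left]
  simp only [conj_trivial]
  rw [div_eq_inv_mul] at h0
  linarith

theorem mem_of_tendsto_weakly [CompleteSpace H] {ι : Type*} {l : Filter ι} [l.NeBot] {K : Set H}
    (hK : Convex ℝ K) (hKc : IsClosed K) {u : ι → H} {u' : H} (hu : ∀ᶠ k in l, u k ∈ K)
    (hlim : ∀ v, Tendsto (fun k => ⟪v, u k⟫_ℝ) l (𝓝 ⟪v, u'⟫_ℝ)) : u' ∈ K := by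
  by_contra hnot
  obtain ⟨φ, c, hφ, hc⟩ := geometric_hahn_banach_point_closed hK hKc hnot
  have h1 := hlim ((InnerProductSpace.toDual ℝ H).symm φ)
  simp only [InnerProductSpace.toDual_symm_apply] at h1
  exact absurd (ge_of_tendsto h1 (hu.mono fun k hk => (hc _ hk).le)) (not_le.2 hφ)

/-- Convex lower semi-continuous functions are weakly lower semi-continuous. -/
theorem IsProperConvexLSC.le_of_tendsto_weakly [CompleteSpace H] {h : H → EReal}
    (hh : IsProperConvexLSC h) {ι : Type*} {l : Filter ι} [l.NeBot] {u : ι → H} {u' : H}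
    (hlim : ∀ v, Tendsto (fun k => ⟪v, u k⟫_ℝ) l (𝓝 ⟪v, u'⟫_ℝ)) {c : ι → ℝ} {c' : ℝ}
    (hc : Tendsto c l (𝓝 c')) (hle : ∀ k, h (u k) ≤ c k) : h u' ≤ c' := by
  refine EReal.le_of_forall_lt_iff_le.1 fun d hd => ?_
  rw [EReal.coe_lt_coe_iff] at hd
  refine mem_of_tendsto_weakly (K := {v | h v ≤ d}) (fun v hv w hw a b ha hb hab => ?_)
    (hh.lsc.isClosed_preimage _) ?_ hlim
  · have h1 := hh.convex_epigraph (x := (v, d)) hv (y := (w, d)) hw ha hb hab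
    have h2 : a * d + b * d = d := by rw [← add_mul, hab, one_mul]
    simpa [epigraph, h2] using h1
  · filter_upwards [hc.eventually_lt_const hd] with k hk
    exact (hle k).trans (EReal.coe_le_coe_iff.2 hk.le)

end Convex

/-! ### Saddle points as solutions of subgradient inclusions. -/

section Saddle

variable {n : ℕ} {X : Type*} {Y : Fin n → Type*}
  [NormedAddCommGroup X] [InnerProductSpace ℝ X]
  [∀ i, NormedAddCommGroup (Y i)] [∀ i, InnerProductSpace ℝ (Y i)]
  {A : ∀ i, X →L[ℝ] Y i} {f : ∀ i, Y i → EReal} {g : X → EReal}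

theorem sum_inner_sub_conj_eq_coe {x : X} {y : ∀ i, Y i} {c : Fin n → ℝ}
    (hc : ∀ i, conj (f i) (y i) = c i) :
    (∑ i, (((⟪A i x, y i⟫_ℝ : ℝ) : EReal) - conj (f i) (y i)))
      = ((∑ i, (⟪A i x, y i⟫_ℝ - c i) : ℝ) : EReal) := by
  simp only [hc, ← EReal.coe_sub]
  exact (map_sum (⟨⟨((↑) : ℝ → EReal), EReal.coe_zero⟩, EReal.coe_add⟩ : ℝ →+ EReal) _ _).symm

theorem lagrangian_eq_coe_add {x : X} {y : ∀ i, Y i} {c : Fin n → ℝ}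
    (hc : ∀ i, conj (f i) (y i) = c i) :
    lagrangian A f g x y = ((∑ i, (⟪A i x, y i⟫_ℝ - c i) : ℝ) : EReal) + g x := by
  rw [lagrangian, sum_inner_sub_conj_eq_coe hc]

theorem lagrangian_eq_bot {x : X} {y : ∀ i, Y i} {j : Fin n} (hj : conj (f j) (y j) = ⊤) :
    lagrangian A f g x y = ⊥ := by
  rw [lagrangian, ← Finset.add_sum_erase _ _ (Finset.mem_univ j), hj, EReal.sub_top,
    EReal.bot_add, EReal.bot_add]

variable [CompleteSpace X] [∀ i, CompleteSpace (Y i)]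

theorem inner_sum_adjoint (A : ∀ i, X →L[ℝ] Y i) (y : ∀ i, Y i) (x : X) :
    ⟪∑ j, ContinuousLinearMap.adjoint (A j) (y j), x⟫_ℝ = ∑ j, ⟪A j x, y j⟫_ℝ := by
  rw [sum_inner]
  exact Finset.sum_congr rfl fun j _ => by
    rw [ContinuousLinearMap.adjoint_inner_left, real_inner_comm]

/-- First-order optimality in each variable; the condition on block `j` comes from varying that
block alone. -/
theorem mem_saddlePoints_iff (hf : ∀ i, IsProperConvexLSC (f i)) (hg : IsProperConvexLSC g)
    {z : X × ∀ i, Y i} :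
    z ∈ saddlePoints A f g ↔
      IsSubgradient g z.1 (-∑ j, ContinuousLinearMap.adjoint (A j) (z.2 j)) ∧
        ∀ j, IsSubgradient (conj (f j)) (z.2 j) (A j z.1) := by
  obtain ⟨x, y⟩ := z
  simp only
  constructor
  · rintro ⟨h1, h2⟩
    simp only at h1 h2
    choose y' hy' using fun i => (hf i).conj.exists_ne_top
    choose c' hc' using fun i => (hf i).conj.exists_eq_coe (hy' i)
    obtain ⟨x', hx'⟩ := hg.exists_ne_top
    obtain ⟨r', hr'⟩ := hg.exists_eq_coe hx'
    -- An infinite conjugate makes the Lagrangian `⊥` whatever `g x` is, and `y'` does strictly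
    -- better.
    have hy : ∀ i, conj (f i) (y i) ≠ ⊤ := by
      intro i hi
      have h3 := h1 y'
      rw [lagrangian_eq_bot hi, le_bot_iff, lagrangian_eq_coe_add hc', EReal.add_eq_bot_iff] at h3
      exact h3.elim (EReal.coe_ne_bot _) (hg.ne_bot x)
    choose c hc using fun i => (hf i).conj.exists_eq_coe (hy i)
    have hx : g x ≠ ⊤ := by
      intro hx
      have h3 := h2 x'
      rw [lagrangian_eq_coe_add hc, lagrangian_eq_coe_add hc, hx, hr', ← EReal.coe_add,
        EReal.coe_add_top, top_le_iff] at h3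
      exact EReal.coe_ne_top _ h3
    obtain ⟨r, hr⟩ := hg.exists_eq_coe hx
    refine ⟨⟨r, hr, fun u => ?_⟩, fun j => ⟨c j, hc j, fun v => ?_⟩⟩
    · by_cases hu : g u = ⊤
      · simp [hu]
      obtain ⟨s, hs⟩ := hg.exists_eq_coe hu
      have h3 := h2 u
      rw [lagrangian_eq_coe_add hc, lagrangian_eq_coe_add hc, hr, hs, ← EReal.coe_add,
        ← EReal.coe_add, EReal.coe_le_coe_iff, Finset.sum_sub_distrib, Finset.sum_sub_distrib] at h3
      rw [hs, EReal.coe_le_coe_iff, inner_neg_left, inner_sum_adjoint]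
      simp only [map_sub, inner_sub_left, Finset.sum_sub_distrib]
      linarith
    · by_cases hv : conj (f j) v = ⊤
      · simp [hv]
      obtain ⟨s, hs⟩ := (hf j).conj.exists_eq_coe hv
      have hc2 : ∀ i, conj (f i) (Function.update y j v i) = (Function.update c j s i : ℝ) := by
        intro i
        by_cases hij : i = j
        · subst hij; simp [hs]
        · simp [hij, hc]
      have h3 := h1 (Function.update y j v)
      rw [lagrangian_eq_coe_add hc, lagrangian_eq_coe_add hc2, hr, ← EReal.coe_add,
        ← EReal.coe_add, EReal.coe_le_coe_iff, ← Finset.add_sum_erase _ _ (Finset.mem_univ j),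
        ← Finset.add_sum_erase _ (fun i => ⟪A i x, y i⟫_ℝ - c i) (Finset.mem_univ j)] at h3
      have h4 : ∑ i ∈ Finset.univ.erase j,
          (⟪A i x, Function.update y j v i⟫_ℝ - Function.update c j s i)
          = ∑ i ∈ Finset.univ.erase j, (⟪A i x, y i⟫_ℝ - c i) := by
        refine Finset.sum_congr rfl fun i hi => ?_
        rw [Function.update_of_ne (Finset.ne_of_mem_erase hi),
          Function.update_of_ne (Finset.ne_of_mem_erase hi)]
      rw [h4, Function.update_self, Function.update_self] at h3
      rw [hs, EReal.coe_le_coe_iff, inner_sub_right]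
      linarith
  · rintro ⟨⟨r, hr, h1⟩, h2⟩
    choose c hc h2 using h2
    refine ⟨fun v => ?_, fun u => ?_⟩
    · simp only
      by_cases hv : ∃ j, conj (f j) (v j) = ⊤
      · obtain ⟨j, hj⟩ := hv
        rw [lagrangian_eq_bot hj]
        exact bot_le
      push Not at hv
      choose s hs using fun i => (hf i).conj.exists_eq_coe (hv i)
      rw [lagrangian_eq_coe_add hc, lagrangian_eq_coe_add hs, hr, ← EReal.coe_add,
        ← EReal.coe_add, EReal.coe_le_coe_iff]
      refine add_le_add_left (Finset.sum_le_sum fun i _ => ?_) r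
      have h3 := h2 i (v i)
      rw [hs, EReal.coe_le_coe_iff, inner_sub_right] at h3
      linarith
    · simp only
      rw [lagrangian_eq_coe_add hc, lagrangian_eq_coe_add hc]
      by_cases hu : g u = ⊤
      · rw [hu, EReal.coe_add_top]
        exact le_top
      obtain ⟨s, hs⟩ := hg.exists_eq_coe hu
      have h3 := h1 u
      rw [hs, EReal.coe_le_coe_iff, inner_neg_left, inner_sum_adjoint] at h3
      simp only [map_sub, inner_sub_left, Finset.sum_sub_distrib] at h3
      rw [hs, hr, ← EReal.coe_add, ← EReal.coe_add, EReal.coe_le_coe_iff, Finset.sum_sub_distrib,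
        Finset.sum_sub_distrib]
      linarith

end Saddle

/-! ### The Lyapunov function and its decrease in one iteration. -/

section OneStep

set_option linter.unusedSectionVars false

variable {n : ℕ} {X : Type*} {Y : Fin n → Type*}
  [NormedAddCommGroup X] [InnerProductSpace ℝ X]
  [∀ i, NormedAddCommGroup (Y i)] [∀ i, InnerProductSpace ℝ (Y i)]
  {A : ∀ i, X →L[ℝ] Y i} {f : ∀ i, Y i → EReal} {g : X → EReal} {p : Fin n → ℝ}

/-- The primal step-size, replaced by `1` if the primal variable is decoupled from all others. -/
noncomputable def effPrimal (A : ∀ i, X →L[ℝ] Y i) (t : ℝ) : ℝ :=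
  open Classical in if ∀ i, A i = 0 then 1 else t

/-- The dual step-sizes, replaced by `1` for the blocks that are decoupled from the primal
variable. -/
noncomputable def effDual (A : ∀ i, X →L[ℝ] Y i) (s : Fin n → ℝ) (i : Fin n) : ℝ :=
  open Classical in if A i = 0 then 1 else s i

theorem effPrimal_pos (A : ∀ i, X →L[ℝ] Y i) {t : ℝ} (ht : 0 < t) : 0 < effPrimal A t := by
  unfold effPrimal
  split_ifs <;> simp [ht]

theorem effDual_pos (A : ∀ i, X →L[ℝ] Y i) {s : Fin n → ℝ} (hs : ∀ i, 0 < s i) (i : Fin n) :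
    0 < effDual A s i := by
  unfold effDual
  split_ifs <;> simp [hs]

theorem effPrimal_mul_effDual_le {β t : ℝ} {s : Fin n → ℝ} (hβ : 0 ≤ β) (hp : ∀ i, 0 < p i)
    (h : ∀ i, t * s i * (‖A i‖ ^ 2 / p i) ≤ β) (i : Fin n) :
    ‖A i‖ ^ 2 * (effPrimal A t * effDual A s i) ≤ β * p i := by
  by_cases hi : A i = 0
  · simp [hi, mul_nonneg hβ (hp i).le]
  · have h1 : ¬ ∀ i, A i = 0 := fun h => hi (h i)
    rw [effPrimal, effDual, if_neg h1, if_neg hi]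
    have h2 := h i
    rw [← mul_div_assoc, div_le_iff₀ (hp i)] at h2
    linarith

theorem one_div_effPrimal_le (A : ∀ i, X →L[ℝ] Y i) {t t' δ : ℝ} (hδ : 0 ≤ δ)
    (h : 1 / t' ≤ (1 + δ) * (1 / t)) :
    1 / effPrimal A t' ≤ (1 + δ) * (1 / effPrimal A t) := by
  unfold effPrimal
  split_ifs
  · simpa using hδ
  · exact h

theorem one_div_effDual_le (A : ∀ i, X →L[ℝ] Y i) {s s' : Fin n → ℝ} {δ : ℝ} (hδ : 0 ≤ δ)
    (h : ∀ i, 1 / s' i ≤ (1 + δ) * (1 / s i)) (i : Fin n) :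
    1 / effDual A s' i ≤ (1 + δ) * (1 / effDual A s i) := by
  unfold effDual
  split_ifs
  · simpa using hδ
  · exact h i

/-- The extrapolation lives on the last sampled block only, so Cauchy-Schwarz and `4 a b ≤ (a + b) ^
2` on one block suffice. This is why a blockwise step-size condition is enough. -/
theorem abs_sum_inner_le {κ t : ℝ} {s : Fin n → ℝ} (hκ : 0 ≤ κ) (ht : 0 < t) (hs : ∀ i, 0 < s i)
    (hp : ∀ i, 0 < p i) (hA : ∀ i, ‖A i‖ ^ 2 * (t * s i) ≤ κ ^ 2 * p i) (v : X) {e : ∀ i, Y i}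
    {i₀ : Fin n} (he : ∀ j, j ≠ i₀ → e j = 0) :
    |∑ i, ⟪A i v, e i⟫_ℝ| ≤ κ * (‖v‖ ^ 2 / (2 * t) + ∑ i, p i * ‖e i‖ ^ 2 / (2 * s i)) := by
  rw [Finset.sum_eq_single i₀ (fun j _ hj => by rw [he j hj, inner_zero_right]) (by simp)]
  have h1 : |⟪A i₀ v, e i₀⟫_ℝ| ≤ ‖A i₀‖ * ‖v‖ * ‖e i₀‖ :=
    (abs_real_inner_le_norm _ _).trans (by gcongr; exact (A i₀).le_opNorm v)
  have h2 : p i₀ * ‖e i₀‖ ^ 2 / (2 * s i₀) ≤ ∑ i, p i * ‖e i‖ ^ 2 / (2 * s i) :=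
    Finset.single_le_sum (f := fun i => p i * ‖e i‖ ^ 2 / (2 * s i))
      (fun i _ => by have := hp i; have := hs i; positivity) (Finset.mem_univ i₀)
  refine h1.trans (le_trans ?_ (mul_le_mul_of_nonneg_left (add_le_add_right h2 _) hκ))
  have hp0 := hp i₀
  have hs0 := hs i₀
  refine le_of_sq_le_sq ?_ (by positivity)
  have h3 : ‖A i₀‖ ^ 2 ≤ κ ^ 2 * (p i₀ / (t * s i₀)) := by
    rw [← mul_div_assoc, le_div_iff₀ (by positivity)]
    exact hA i₀
  calc (‖A i₀‖ * ‖v‖ * ‖e i₀‖) ^ 2 = ‖A i₀‖ ^ 2 * (‖v‖ ^ 2 * ‖e i₀‖ ^ 2) := by ring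
    _ ≤ κ ^ 2 * (p i₀ / (t * s i₀)) * (‖v‖ ^ 2 * ‖e i₀‖ ^ 2) := by gcongr
    _ = κ ^ 2 * (4 * (‖v‖ ^ 2 / (2 * t)) * (p i₀ * ‖e i₀‖ ^ 2 / (2 * s i₀))) := by
        field_simp
        ring
    _ ≤ κ ^ 2 * (‖v‖ ^ 2 / (2 * t) + p i₀ * ‖e i₀‖ ^ 2 / (2 * s i₀)) ^ 2 := by
        gcongr
        nlinarith [sq_nonneg (‖v‖ ^ 2 / (2 * t) - p i₀ * ‖e i₀‖ ^ 2 / (2 * s i₀))]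
    _ = _ := by ring

/-- The quadratic part of the Lyapunov function. -/
noncomputable def quad (p : Fin n → ℝ) (κ : ℝ) (z : X × ∀ i, Y i) (t : ℝ) (s : Fin n → ℝ)
    (S : State X Y) : ℝ :=
  ‖S.x - z.1‖ ^ 2 / (2 * t) + ∑ j, (‖S.y j - z.2 j‖ ^ 2 / (2 * s j * p j)
    + (1 + κ) / 2 * (p j * ‖S.ybar j - S.y j‖ ^ 2 / (2 * s j)))

/-- The Lyapunov function of the algorithm, relative to the saddle point `z`. -/
noncomputable def lyap (A : ∀ i, X →L[ℝ] Y i) (p : Fin n → ℝ) (κ : ℝ) (z : X × ∀ i, Y i)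
    (t : ℝ) (s : Fin n → ℝ) (S : State X Y) : ℝ :=
  ‖S.x - z.1‖ ^ 2 / (2 * t) + ∑ j, (‖S.y j - z.2 j‖ ^ 2 / (2 * s j * p j)
    - ⟪A j (S.x - z.1), S.ybar j - S.y j⟫_ℝ
    + (1 + κ) / 2 * (p j * ‖S.ybar j - S.y j‖ ^ 2 / (2 * s j)))

theorem lyap_eq_quad_sub (A : ∀ i, X →L[ℝ] Y i) (p : Fin n → ℝ) (κ : ℝ) (z : X × ∀ i, Y i)
    (t : ℝ) (s : Fin n → ℝ) (S : State X Y) :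
    lyap A p κ z t s S
      = quad p κ z t s S - ∑ j, ⟪A j (S.x - z.1), S.ybar j - S.y j⟫_ℝ := by
  simp only [lyap, quad, Finset.sum_add_distrib, Finset.sum_sub_distrib]
  ring

theorem quad_le_mul_quad {κ t t' δ : ℝ} {s s' : Fin n → ℝ} (hκ : 0 ≤ κ) (hp : ∀ i, 0 < p i)
    (ht : 1 / t' ≤ (1 + δ) * (1 / t)) (hs : ∀ i, 1 / s' i ≤ (1 + δ) * (1 / s i))
    (z : X × ∀ i, Y i) (S : State X Y) :
    quad p κ z t' s' S ≤ (1 + δ) * quad p κ z t s S := by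
  unfold quad
  rw [mul_add, Finset.mul_sum]
  refine add_le_add ?_ (Finset.sum_le_sum fun j _ => ?_)
  · calc ‖S.x - z.1‖ ^ 2 / (2 * t') = ‖S.x - z.1‖ ^ 2 / 2 * (1 / t') := by ring
      _ ≤ ‖S.x - z.1‖ ^ 2 / 2 * ((1 + δ) * (1 / t)) := by gcongr
      _ = _ := by ring
  · have hpj := hp j
    calc _ = (‖S.y j - z.2 j‖ ^ 2 / (2 * p j)
          + (1 + κ) / 2 * (p j * ‖S.ybar j - S.y j‖ ^ 2 / 2)) * (1 / s' j) := by ring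
      _ ≤ (‖S.y j - z.2 j‖ ^ 2 / (2 * p j)
          + (1 + κ) / 2 * (p j * ‖S.ybar j - S.y j‖ ^ 2 / 2)) * ((1 + δ) * (1 / s j)) := by
        gcongr
        exact hs j
      _ = _ := by ring

/-- The cross term costs at most `κ` times the primal and extrapolation parts, and the weight `(1 +
κ) / 2` exceeds `κ`. That weight must also stay below `1` to be paid for by the dual increments in
`sum_mul_lyap_step_le`, whence the midpoint. -/
theorem mul_quad_le_lyap {κ t : ℝ} {s : Fin n → ℝ} (hκ : 0 ≤ κ) (hκ' : κ < 1) (ht : 0 < t)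
    (hs : ∀ i, 0 < s i) (hp : ∀ i, 0 < p i) (hA : ∀ i, ‖A i‖ ^ 2 * (t * s i) ≤ κ ^ 2 * p i)
    (z : X × ∀ i, Y i) {S : State X Y} {i₀ : Fin n} (hS : ∀ j, j ≠ i₀ → S.ybar j = S.y j) :
    (1 - κ) / 2 * quad p κ z t s S ≤ lyap A p κ z t s S := by
  have h1 := (abs_le.1 (abs_sum_inner_le hκ ht hs hp hA (S.x - z.1)
    (e := fun j => S.ybar j - S.y j) (i₀ := i₀) (fun j hj => by rw [hS j hj, sub_self]))).2
  rw [lyap_eq_quad_sub]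
  have h2 : quad p κ z t s S = ‖S.x - z.1‖ ^ 2 / (2 * t)
      + ∑ j, ‖S.y j - z.2 j‖ ^ 2 / (2 * s j * p j)
      + (1 + κ) / 2 * ∑ j, p j * ‖S.ybar j - S.y j‖ ^ 2 / (2 * s j) := by
    simp only [quad, Finset.sum_add_distrib, Finset.mul_sum]
    ring
  rw [h2]
  have a1 : 0 ≤ ‖S.x - z.1‖ ^ 2 / (2 * t) := by positivity
  have a2 : 0 ≤ ∑ j, ‖S.y j - z.2 j‖ ^ 2 / (2 * s j * p j) :=
    Finset.sum_nonneg fun j _ => by have := hp j; have := hs j; positivity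
  have a3 : 0 ≤ ∑ j, p j * ‖S.ybar j - S.y j‖ ^ 2 / (2 * s j) :=
    Finset.sum_nonneg fun j _ => by have := hp j; have := hs j; positivity
  generalize ‖S.x - z.1‖ ^ 2 / (2 * t) = a at *
  generalize ∑ j, ‖S.y j - z.2 j‖ ^ 2 / (2 * s j * p j) = b at *
  generalize ∑ j, p j * ‖S.ybar j - S.y j‖ ^ 2 / (2 * s j) = d at *
  have b1 : 0 ≤ (1 - κ) * a := mul_nonneg (by linarith) a1
  have b2 : 0 ≤ (1 + κ) * b := mul_nonneg (by linarith) a2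
  have b3 : 0 ≤ (1 - κ) * ((1 - κ) * d) := mul_nonneg (by linarith) (mul_nonneg (by linarith) a3)
  nlinarith

theorem quad_nonneg {κ t : ℝ} {s : Fin n → ℝ} (hκ : 0 ≤ κ) (ht : 0 < t)
    (hs : ∀ i, 0 < s i) (hp : ∀ i, 0 < p i) (z : X × ∀ i, Y i) (S : State X Y) :
    0 ≤ quad p κ z t s S := by
  refine add_nonneg (by positivity) (Finset.sum_nonneg fun j _ => ?_)
  have := hp j
  have := hs j
  positivity

theorem lyap_nonneg {κ t : ℝ} {s : Fin n → ℝ} (hκ : 0 ≤ κ) (hκ' : κ < 1) (ht : 0 < t)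
    (hs : ∀ i, 0 < s i) (hp : ∀ i, 0 < p i) (hA : ∀ i, ‖A i‖ ^ 2 * (t * s i) ≤ κ ^ 2 * p i)
    (z : X × ∀ i, Y i) {S : State X Y} {i₀ : Fin n} (hS : ∀ j, j ≠ i₀ → S.ybar j = S.y j) :
    0 ≤ lyap A p κ z t s S :=
  (mul_nonneg (by linarith) (quad_nonneg hκ ht hs hp z S)).trans
    (mul_quad_le_lyap hκ hκ' ht hs hp hA z hS)

/-- The cross term contains no step-size, so the increase is at most `δ` times `quad`, itself
controlled by `lyap`. -/
theorem lyap_le_mul_lyap {κ t t' δ : ℝ} {s s' : Fin n → ℝ} (hκ : 0 ≤ κ) (hκ' : κ < 1) (ht : 0 < t)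
    (hs : ∀ i, 0 < s i) (hp : ∀ i, 0 < p i) (hA : ∀ i, ‖A i‖ ^ 2 * (t * s i) ≤ κ ^ 2 * p i)
    (hδ : 0 ≤ δ) (htt : 1 / t' ≤ (1 + δ) * (1 / t)) (hss : ∀ i, 1 / s' i ≤ (1 + δ) * (1 / s i))
    (z : X × ∀ i, Y i) {S : State X Y} {i₀ : Fin n} (hS : ∀ j, j ≠ i₀ → S.ybar j = S.y j) :
    lyap A p κ z t' s' S ≤ (1 + 2 * δ / (1 - κ)) * lyap A p κ z t s S := by
  have h1 := mul_quad_le_lyap hκ hκ' ht hs hp hA z hS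
  have h2 := quad_le_mul_quad hκ hp htt hss z S
  have h3 : quad p κ z t s S ≤ 2 / (1 - κ) * lyap A p κ z t s S := by
    have : (0 : ℝ) < 1 - κ := by linarith
    rw [div_mul_eq_mul_div, le_div_iff₀ this]
    linarith
  have h4 := mul_le_mul_of_nonneg_left h3 hδ
  rw [lyap_eq_quad_sub] at h4 ⊢
  rw [lyap_eq_quad_sub A p κ z t s S]
  calc _ ≤ _ := sub_le_sub_right h2 _
    _ = quad p κ z t s S - ∑ j, ⟪A j (S.x - z.1), S.ybar j - S.y j⟫_ℝ
        + δ * quad p κ z t s S := by ring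
    _ ≤ _ := add_le_add_right h4 _
    _ = _ := by ring

theorem sum_mul_sum_ite {a b : Fin n → ℝ} (hp : ∑ i, p i = 1) :
    ∑ i, p i * ∑ j, (if j = i then a j else b j) = ∑ j, (p j * a j + (1 - p j) * b j) := by
  have h1 : ∀ i, ∑ j, (if j = i then a j else b j) = (∑ j, b j) + (a i - b i) := by
    intro i
    rw [← sub_eq_iff_eq_add', ← Finset.sum_sub_distrib, Finset.sum_eq_single i]
    · simp
    · intro j _ hj
      simp [hj]
    · simp
  simp only [h1, mul_add, Finset.sum_add_distrib, ← Finset.sum_mul, hp, one_mul]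
  rw [← Finset.sum_add_distrib, ← Finset.sum_add_distrib]
  exact Finset.sum_congr rfl fun j _ => by ring

theorem two_mul_inner_sub_sub {H : Type*} [NormedAddCommGroup H] [InnerProductSpace ℝ H]
    (x x' z : H) :
    2 * ⟪x - x', x' - z⟫_ℝ = ‖x - z‖ ^ 2 - ‖x' - x‖ ^ 2 - ‖x' - z‖ ^ 2 := by
  have h1 : x - z = (x - x') + (x' - z) := by abel
  rw [h1, norm_add_sq_real, norm_sub_rev x' x]
  ring

variable [CompleteSpace X] [∀ i, CompleteSpace (Y i)]

/-- The primal iterate that follows the state `S`. -/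
noncomputable def xNext (A : ∀ i, X →L[ℝ] Y i) (g : X → EReal) (t : ℝ) (S : State X Y) : X :=
  prox t g (S.x - t • ∑ j, ContinuousLinearMap.adjoint (A j) (S.ybar j))

/-- The candidate for the next value of the dual variable `j`, used if `j` is selected. -/
noncomputable def yNext (A : ∀ i, X →L[ℝ] Y i) (f : ∀ i, Y i → EReal) (g : X → EReal)
    (t : ℝ) (s : Fin n → ℝ) (S : State X Y) (j : Fin n) : Y j :=
  prox (s j) (conj (f j)) (S.y j + s j • A j (xNext A g t S))

theorem step_x (t : ℝ) (s : Fin n → ℝ) (i : Fin n) (S : State X Y) :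
    (step A f g p t s i S).x = xNext A g t S := rfl

theorem step_y (t : ℝ) (s : Fin n → ℝ) (i : Fin n) (S : State X Y) (j : Fin n) :
    (step A f g p t s i S).y j = if j = i then yNext A f g t s S j else S.y j := rfl

theorem step_ybar_sub_y (t : ℝ) (s : Fin n → ℝ) (i : Fin n) (S : State X Y) (j : Fin n) :
    (step A f g p t s i S).ybar j - (step A f g p t s i S).y j
      = if j = i then (1 / p j) • (yNext A f g t s S j - S.y j) else 0 := by
  by_cases hj : j = i
  · simp [step, hj, yNext, xNext]
  · simp [step, hj]

theorem isSubgradient_xNext (hg : IsProperConvexLSC g) {t : ℝ} (ht : 0 < t) (S : State X Y) :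
    IsSubgradient g (xNext A g t S)
      (t⁻¹ • (S.x - xNext A g t S) - ∑ j, ContinuousLinearMap.adjoint (A j) (S.ybar j)) := by
  have h1 := hg.isSubgradient_prox ht (S.x - t • ∑ j, ContinuousLinearMap.adjoint (A j) (S.ybar j))
  have h2 : t⁻¹ • (S.x - t • ∑ j, ContinuousLinearMap.adjoint (A j) (S.ybar j) - xNext A g t S)
      = t⁻¹ • (S.x - xNext A g t S) - ∑ j, ContinuousLinearMap.adjoint (A j) (S.ybar j) := by
    rw [sub_right_comm, smul_sub, inv_smul_smul₀ ht.ne']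
  rw [← h2]
  exact h1

theorem isSubgradient_yNext (hf : ∀ i, IsProperConvexLSC (f i)) {t : ℝ} {s : Fin n → ℝ}
    (hs : ∀ i, 0 < s i) (S : State X Y) (j : Fin n) :
    IsSubgradient (conj (f j)) (yNext A f g t s S j)
      ((s j)⁻¹ • (S.y j - yNext A f g t s S j) + A j (xNext A g t S)) := by
  have h1 := (hf j).conj.isSubgradient_prox (hs j) (S.y j + s j • A j (xNext A g t S))
  have h2 : (s j)⁻¹ • (S.y j + s j • A j (xNext A g t S) - yNext A f g t s S j)
      = (s j)⁻¹ • (S.y j - yNext A f g t s S j) + A j (xNext A g t S) := by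
    rw [add_sub_right_comm, smul_add, inv_smul_smul₀ (hs j).ne']
  rw [← h2]
  exact h1

theorem norm_xNext_sub_sq_le (hf : ∀ i, IsProperConvexLSC (f i)) (hg : IsProperConvexLSC g)
    {z : X × ∀ i, Y i} (hz : z ∈ saddlePoints A f g) {t : ℝ} (ht : 0 < t) (S : State X Y) :
    ‖xNext A g t S - z.1‖ ^ 2 / (2 * effPrimal A t) ≤ ‖S.x - z.1‖ ^ 2 / (2 * effPrimal A t)
      - ‖xNext A g t S - S.x‖ ^ 2 / (2 * effPrimal A t)
      - ∑ j, ⟪A j (xNext A g t S - z.1), S.ybar j - z.2 j⟫_ℝ := by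
  have h1 := (isSubgradient_xNext (A := A) hg ht S).monotone ((mem_saddlePoints_iff hf hg).1 hz).1
  set x' := xNext A g t S
  rw [sub_neg_eq_add, inner_add_left, inner_sub_left, inner_smul_left, inner_sum_adjoint,
    inner_sum_adjoint] at h1
  simp only [conj_trivial] at h1
  have h2 := two_mul_inner_sub_sub S.x x' z.1
  simp only [inner_sub_right, Finset.sum_sub_distrib]
  have key : 0 ≤ (2 * ⟪S.x - x', x' - z.1⟫_ℝ) / (2 * effPrimal A t)
      - ∑ j, ⟪A j (x' - z.1), S.ybar j⟫_ℝ + ∑ j, ⟪A j (x' - z.1), z.2 j⟫_ℝ := by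
    -- Without coupling, the monotonicity inequality is homogeneous in the inverse step-size, so any
    -- positive weight may replace it. The dual estimate below uses the same fact.
    by_cases hA : ∀ i, A i = 0
    · simp only [hA, zero_apply, inner_zero_left, Finset.sum_const_zero,
        sub_zero, add_zero] at h1 ⊢
      rw [effPrimal, if_pos hA]
      have := nonneg_of_mul_nonneg_right h1 (inv_pos.2 ht)
      linarith
    · rw [effPrimal, if_neg hA, mul_div_mul_left _ _ two_ne_zero, div_eq_inv_mul]
      linarith
  rw [h2, sub_div, sub_div] at key
  linarith

theorem norm_yNext_sub_sq_le (hf : ∀ i, IsProperConvexLSC (f i)) (hg : IsProperConvexLSC g)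
    {z : X × ∀ i, Y i} (hz : z ∈ saddlePoints A f g) {t : ℝ} {s : Fin n → ℝ}
    (hs : ∀ i, 0 < s i) (S : State X Y) (j : Fin n) :
    ‖yNext A f g t s S j - z.2 j‖ ^ 2 / (2 * effDual A s j)
      ≤ ‖S.y j - z.2 j‖ ^ 2 / (2 * effDual A s j)
      - ‖yNext A f g t s S j - S.y j‖ ^ 2 / (2 * effDual A s j)
      + ⟪A j (xNext A g t S - z.1), yNext A f g t s S j - z.2 j⟫_ℝ := by
  have h1 := (isSubgradient_yNext (A := A) (g := g) (t := t) hf hs S j).monotone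
    (((mem_saddlePoints_iff hf hg).1 hz).2 j)
  set x' := xNext A g t S
  set y' := yNext A f g t s S j
  rw [add_sub_assoc, ← map_sub, inner_add_left, inner_smul_left] at h1
  simp only [conj_trivial] at h1
  have h2 := two_mul_inner_sub_sub (S.y j) y' (z.2 j)
  have key : 0 ≤ (2 * ⟪S.y j - y', y' - z.2 j⟫_ℝ) / (2 * effDual A s j)
      + ⟪A j (x' - z.1), y' - z.2 j⟫_ℝ := by
    by_cases hA : A j = 0
    · simp only [hA, zero_apply, inner_zero_left, add_zero] at h1 ⊢
      rw [effDual, if_pos hA]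
      have := nonneg_of_mul_nonneg_right h1 (inv_pos.2 (hs j))
      linarith
    · rw [effDual, if_neg hA, mul_div_mul_left _ _ two_ne_zero, div_eq_inv_mul]
      linarith
  rw [h2, sub_div, sub_div] at key
  linarith

/-- The decrease of the Lyapunov function in one iteration. -/
noncomputable def drift (A : ∀ i, X →L[ℝ] Y i) (f : ∀ i, Y i → EReal) (g : X → EReal)
    (κ t : ℝ) (s : Fin n → ℝ) (S : State X Y) : ℝ :=
  (1 - κ) / 2 * (‖xNext A g t S - S.x‖ ^ 2 / (2 * effPrimal A t)
    + ∑ j, ‖yNext A f g t s S j - S.y j‖ ^ 2 / (2 * effDual A s j))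

/-- The weights `1 / p j` and the factor `1 / p j` in the extrapolation make the average over `i`
behave like a full dual update `yNext` of all blocks. The dual increments pay for the newly created
extrapolation term, of weight `(1 + κ) / 2`; the old one and the primal increment pay for the
remaining cross term, of weight `κ`. -/
theorem sum_mul_lyap_step_le (hf : ∀ i, IsProperConvexLSC (f i)) (hg : IsProperConvexLSC g)
    {z : X × ∀ i, Y i} (hz : z ∈ saddlePoints A f g) {κ t : ℝ} {s : Fin n → ℝ} (hκ : 0 ≤ κ)
    (hκ' : κ < 1) (ht : 0 < t) (hs : ∀ i, 0 < s i) (hp : ∀ i, 0 < p i) (hp1 : ∑ i, p i = 1)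
    (hA : ∀ i, ‖A i‖ ^ 2 * (effPrimal A t * effDual A s i) ≤ κ ^ 2 * p i) {S : State X Y}
    {i₀ : Fin n} (hS : ∀ j, j ≠ i₀ → S.ybar j = S.y j) :
    ∑ i, p i * lyap A p κ z (effPrimal A t) (effDual A s) (step A f g p t s i S)
      ≤ lyap A p κ z (effPrimal A t) (effDual A s) S - drift A f g κ t s S := by
  have hX := norm_xNext_sub_sq_le hf hg hz ht S
  have hY := norm_yNext_sub_sq_le (A := A) (g := g) hf hg hz (t := t) hs S
  have ht' := effPrimal_pos A ht
  have hs' := effDual_pos A hs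
  set t' := effPrimal A t with ht'_def
  set s' := effDual A s with hs'_def
  set x' := xNext A g t S with hx'
  set y' := yNext A f g t s S with hy'
  have hcross := (abs_le.1 (abs_sum_inner_le hκ ht' hs' hp hA (x' - S.x)
    (e := fun j => S.ybar j - S.y j) (i₀ := i₀) (fun j hj => by rw [hS j hj, sub_self]))).1
  -- Contribution of block `j` to the new `lyap` if it is drawn (`a`) or not (`b`, where the
  -- extrapolation is zero).
  set a : Fin n → ℝ := fun j => ‖y' j - z.2 j‖ ^ 2 / (2 * s' j * p j)
    - ⟪A j (x' - z.1), (1 / p j) • (y' j - S.y j)⟫_ℝ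
    + (1 + κ) / 2 * (p j * ‖(1 / p j) • (y' j - S.y j)‖ ^ 2 / (2 * s' j)) with ha
  set b : Fin n → ℝ := fun j => ‖S.y j - z.2 j‖ ^ 2 / (2 * s' j * p j) with hb
  have h1 : ∀ i, lyap A p κ z t' s' (step A f g p t s i S)
      = ‖x' - z.1‖ ^ 2 / (2 * t') + ∑ j, (if j = i then a j else b j) := by
    intro i
    unfold lyap
    congr 1
    refine Finset.sum_congr rfl fun j _ => ?_
    rw [step_ybar_sub_y, step_y, step_x]
    by_cases hj : j = i
    · subst hj
      simp only [if_true, ha]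
      rfl
    · simp [hj, hb]
  have h2 : ∀ j, p j * a j + (1 - p j) * b j ≤ b j - (1 - κ) / 2 * (‖y' j - S.y j‖ ^ 2 / (2 * s' j))
      + ⟪A j (x' - z.1), S.y j - z.2 j⟫_ℝ := by
    intro j
    have hpj := hp j
    have hsj := hs' j
    have e1 : p j * a j = ‖y' j - z.2 j‖ ^ 2 / (2 * s' j) - ⟪A j (x' - z.1), y' j - S.y j⟫_ℝ
        + (1 + κ) / 2 * (‖y' j - S.y j‖ ^ 2 / (2 * s' j)) := by
      simp only [ha, inner_smul_right, norm_smul, Real.norm_of_nonneg (one_div_pos.2 hpj).le]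
      field_simp
    have e2 : p j * b j = ‖S.y j - z.2 j‖ ^ 2 / (2 * s' j) := by
      simp only [hb]
      field_simp
    have e3 : ⟪A j (x' - z.1), S.y j - z.2 j⟫_ℝ
        = ⟪A j (x' - z.1), y' j - z.2 j⟫_ℝ - ⟪A j (x' - z.1), y' j - S.y j⟫_ℝ := by
      rw [← inner_sub_right]
      congr 1
      abel
    rw [e1, sub_mul, one_mul, e2, e3]
    linarith [hY j]
  -- The primal step sees `ybar`, the averaged dual step sees `y`. Splitting `x' - z.1` at `S.x`
  -- yields the cross term of the old `lyap` and an error bounded by `hcross`.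
  have h3 : ∑ j, ⟪A j (x' - z.1), S.y j - z.2 j⟫_ℝ - ∑ j, ⟪A j (x' - z.1), S.ybar j - z.2 j⟫_ℝ
      = - ∑ j, ⟪A j (S.x - z.1), S.ybar j - S.y j⟫_ℝ
        - ∑ j, ⟪A j (x' - S.x), S.ybar j - S.y j⟫_ℝ := by
    simp only [← Finset.sum_sub_distrib, ← Finset.sum_neg_distrib]
    refine Finset.sum_congr rfl fun j _ => ?_
    simp only [map_sub, inner_sub_left, inner_sub_right]
    ring
  have h4 := Finset.sum_le_sum fun j (_ : j ∈ Finset.univ) => h2 j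
  simp only [h1, mul_add, Finset.sum_add_distrib, ← Finset.sum_mul, hp1, one_mul]
  rw [sum_mul_sum_ite hp1, lyap_eq_quad_sub, drift]
  have h5 : quad p κ z t' s' S = ‖S.x - z.1‖ ^ 2 / (2 * t') + ∑ j, b j
      + (1 + κ) / 2 * ∑ j, p j * ‖S.ybar j - S.y j‖ ^ 2 / (2 * s' j) := by
    simp only [quad, Finset.sum_add_distrib, Finset.mul_sum, hb]
    ring
  rw [h5]
  simp only [Finset.sum_add_distrib, Finset.sum_sub_distrib, ← Finset.mul_sum] at h4
  have a1 : 0 ≤ ‖x' - S.x‖ ^ 2 / (2 * t') := by positivity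
  have a3 : 0 ≤ ∑ j, p j * ‖S.ybar j - S.y j‖ ^ 2 / (2 * s' j) :=
    Finset.sum_nonneg fun j _ => by have := hp j; have := hs' j; positivity
  simp only [Finset.sum_add_distrib] at h4 ⊢
  rw [← hx', ← hy', ← ht'_def, ← hs'_def]
  have b1 : 0 ≤ (1 - κ) * (‖x' - S.x‖ ^ 2 / (2 * t')) := mul_nonneg (by linarith) a1
  have b3 : 0 ≤ (1 - κ) * ∑ j, p j * ‖S.ybar j - S.y j‖ ^ 2 / (2 * s' j) :=
    mul_nonneg (by linarith) a3
  linarith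

theorem drift_nonneg {κ t : ℝ} {s : Fin n → ℝ} (hκ' : κ < 1) (ht : 0 < t) (hs : ∀ i, 0 < s i)
    (S : State X Y) : 0 ≤ drift A f g κ t s S := by
  have := effPrimal_pos A ht
  refine mul_nonneg (by linarith) (add_nonneg (by positivity) (Finset.sum_nonneg fun j _ => ?_))
  have := effDual_pos A hs j
  positivity

end OneStep

/-! ### Almost supermartingales. -/

section Supermartingale

variable {Ω : Type*} {m₀ : MeasurableSpace Ω} {μ : Measure Ω}

theorem _root_.MeasureTheory.Supermartingale.exists_ae_tendsto_of_nonneg [IsFiniteMeasure μ]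
    {ℱ : Filtration ℕ m₀} {N : ℕ → Ω → ℝ} (hN : Supermartingale N ℱ μ)
    (hnonneg : ∀ k, 0 ≤ᵐ[μ] N k) :
    ∀ᵐ ω ∂μ, ∃ c, Tendsto (fun k => N k ω) atTop (𝓝 c) := by
  have hbdd : ∀ k, eLpNorm ((-N) k) 1 μ ≤ (∫ ω, N 0 ω ∂μ).toNNReal := by
    intro k
    rw [Pi.neg_apply, eLpNorm_neg, eLpNorm_one_eq_lintegral_enorm]
    have h1 : ∫⁻ ω, ‖N k ω‖ₑ ∂μ = ENNReal.ofReal (∫ ω, N k ω ∂μ) := by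
      rw [ofReal_integral_eq_lintegral_ofReal (hN.integrable k) (hnonneg k)]
      refine lintegral_congr_ae ?_
      filter_upwards [hnonneg k] with ω hω
      exact Real.enorm_of_nonneg hω
    rw [h1]
    refine ENNReal.ofReal_le_ofReal ?_
    have := hN.setIntegral_le (Nat.zero_le k) MeasurableSet.univ
    simpa using this
  filter_upwards [hN.neg.exists_ae_tendsto_of_bdd hbdd] with ω ⟨c, hc⟩
  exact ⟨-c, by simpa using hc.neg⟩

/-- The Robbins-Siegmund theorem, for deterministic relative perturbations. -/
theorem ae_tendsto_and_summable_of_condExp_le [IsFiniteMeasure μ] {ℱ : Filtration ℕ m₀}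
    {V D : ℕ → Ω → ℝ} {ε : ℕ → ℝ} (hVm : ∀ k, StronglyMeasurable[ℱ k] (V k))
    (hDm : ∀ k, StronglyMeasurable[ℱ k] (D k)) (hVi : ∀ k, Integrable (V k) μ)
    (hDi : ∀ k, Integrable (D k) μ) (hV : ∀ᵐ ω ∂μ, ∀ k, 0 ≤ V k ω) (hD : ∀ᵐ ω ∂μ, ∀ k, 0 ≤ D k ω)
    (hε : ∀ k, 0 ≤ ε k) (hεs : Summable ε)
    (hstep : ∀ k, ∀ᵐ ω ∂μ, (μ[V (k + 1) | ℱ k]) ω ≤ (1 + ε k) * V k ω - D k ω) :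
    ∀ᵐ ω ∂μ, (∃ c, Tendsto (fun k => V k ω) atTop (𝓝 c)) ∧ Summable fun k => D k ω := by
  set P : ℕ → ℝ := fun k => ∏ j ∈ Finset.range k, (1 + ε j) with hP
  have hPpos : ∀ k, 0 < P k := fun k => Finset.prod_pos fun j _ => by linarith [hε j]
  have hPsucc : ∀ k, P (k + 1) = P k * (1 + ε k) := fun k => Finset.prod_range_succ _ _
  obtain ⟨P', hP'⟩ : ∃ P', Tendsto P atTop (𝓝 P') :=
    ⟨_, (Real.multipliable_one_add_of_summable hεs).hasProd.tendsto_prod_nat⟩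
  set R : ℕ → Ω → ℝ := fun k ω => ∑ j ∈ Finset.range k, D j ω / P (j + 1) with hR
  -- Division by the products `P` removes the factors `1 + ε k`, and adding the rescaled past
  -- decreases leaves a nonnegative supermartingale.
  set N : ℕ → Ω → ℝ := fun k ω => V k ω / P k + R k ω with hN
  -- `R (k + 1)` involves `D` only up to time `k`, so conditioning on `ℱ k` leaves it unchanged.
  have hRm : ∀ k, StronglyMeasurable[ℱ k] (R (k + 1)) := fun k =>
    Finset.stronglyMeasurable_fun_sum _ fun j hj => by
      have h1 : StronglyMeasurable[ℱ k] (D j) :=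
        (hDm j).mono (ℱ.mono (Nat.lt_succ_iff.1 (Finset.mem_range.1 hj)))
      simp only [div_eq_mul_inv]
      exact h1.mul_const _
  have hRm' : ∀ k, StronglyMeasurable[ℱ k] (R k) := fun k =>
    Finset.stronglyMeasurable_fun_sum _ fun j hj => by
      have h1 : StronglyMeasurable[ℱ k] (D j) :=
        (hDm j).mono (ℱ.mono (Finset.mem_range.1 hj).le)
      simp only [div_eq_mul_inv]
      exact h1.mul_const _
  have hRi : ∀ k, Integrable (R k) μ := fun k =>
    integrable_finsetSum _ fun j _ => (hDi j).div_const _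
  have hsuper : Supermartingale N ℱ μ := by
    refine supermartingale_nat (fun k => ?_) (fun k => ((hVi k).div_const _).add (hRi k))
      fun k => ?_
    · simp only [hN, div_eq_mul_inv]
      exact ((hVm k).mul_const _).add (hRm' k)
    · have h1 : N (k + 1) = (P (k + 1))⁻¹ • V (k + 1) + R (k + 1) := by
        ext ω
        simp [hN, div_eq_inv_mul]
      rw [h1]
      filter_upwards [condExp_add ((hVi (k + 1)).smul (P (k + 1))⁻¹) (hRi (k + 1)) (ℱ k),
        condExp_smul (P (k + 1))⁻¹ (V (k + 1)) (ℱ k) (μ := μ), hstep k] with ω h2 h3 h4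
      rw [h2, Pi.add_apply, h3, condExp_of_stronglyMeasurable (ℱ.le k) (hRm k) (hRi (k + 1))]
      have h5 : R (k + 1) ω = R k ω + D k ω / P (k + 1) := Finset.sum_range_succ _ _
      have h6 := hPpos k
      have h7 : 0 < 1 + ε k := by linarith [hε k]
      rw [Pi.smul_apply, smul_eq_mul, h5]
      calc _ ≤ (P (k + 1))⁻¹ * ((1 + ε k) * V k ω - D k ω) + (R k ω + D k ω / P (k + 1)) := by
            have := hPpos (k + 1)
            gcongr
        _ = N k ω := by
            simp only [hN, hPsucc]
            field_simp
            ring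
  have hNnonneg : ∀ k, 0 ≤ᵐ[μ] N k := by
    intro k
    filter_upwards [hV, hD] with ω h1 h2
    exact add_nonneg (div_nonneg (h1 k) (hPpos k).le)
      (Finset.sum_nonneg fun j _ => div_nonneg (h2 j) (hPpos _).le)
  filter_upwards [hsuper.exists_ae_tendsto_of_nonneg hNnonneg, hV, hD] with ω ⟨c, hc⟩ h1 h2
  obtain ⟨B, hB⟩ := hc.bddAbove_range
  have hsum : Summable fun j => D j ω / P (j + 1) := by
    refine summable_of_sum_range_le (c := B) (fun j => div_nonneg (h2 j) (hPpos _).le) fun k => ?_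
    refine le_trans ?_ (hB ⟨k, rfl⟩)
    exact le_add_of_nonneg_left (div_nonneg (h1 k) (hPpos k).le)
  constructor
  · refine ⟨_, ((hc.sub hsum.hasSum.tendsto_sum_nat).mul hP').congr fun k => ?_⟩
    have := (hPpos k).ne'
    simp only [hN, hR]
    field_simp
    ring
  · obtain ⟨B', hB'⟩ := hP'.bddAbove_range
    refine Summable.of_nonneg_of_le h2 (fun j => ?_) (hsum.mul_left B')
    calc D j ω = P (j + 1) * (D j ω / P (j + 1)) := by
          have := (hPpos (j + 1)).ne'
          field_simp
      _ ≤ B' * (D j ω / P (j + 1)) := by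
          have := div_nonneg (h2 j) (hPpos (j + 1)).le
          gcongr
          exact hB' ⟨j + 1, rfl⟩

end Supermartingale

/-! ### Functions of the past indices, and averaging over the next one. -/

section Past

variable {Ω E : Type*} {n : ℕ}

/-- `u` is a function of `I 0, …, I (k - 1)`. -/
def DependsOnPast (I : ℕ → Ω → Fin n) (k : ℕ) (u : Ω → E) : Prop :=
  ∀ ω ω', (∀ l < k, I l ω = I l ω') → u ω = u ω'

theorem DependsOnPast.mono {I : ℕ → Ω → Fin n} {k l : ℕ} {u : Ω → E} (hu : DependsOnPast I k u)
    (hkl : k ≤ l) : DependsOnPast I l u :=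
  fun ω ω' h => hu ω ω' fun j hj => h j (hj.trans_le hkl)

theorem DependsOnPast.exists_eq_comp {I : ℕ → Ω → Fin n} {k : ℕ} {u : Ω → E}
    (hu : DependsOnPast I k u) [Nonempty Ω] :
    ∃ U : (Fin k → Fin n) → E, u = U ∘ fun ω l => I l ω := by
  have hfac : Function.FactorsThrough u (fun ω (l : Fin k) => I l ω) :=
    fun ω ω' h => hu ω ω' fun l hl => congrFun h ⟨l, hl⟩
  refine ⟨Function.extend (fun ω (l : Fin k) => I l ω) u fun _ => u (Classical.arbitrary Ω), ?_⟩
  ext1 ω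
  exact (hfac.extend_apply _ ω).symm

theorem DependsOnPast.finite_range {I : ℕ → Ω → Fin n} {k : ℕ} {u : Ω → E}
    (hu : DependsOnPast I k u) [Nonempty Ω] : (Set.range u).Finite := by
  obtain ⟨U, rfl⟩ := hu.exists_eq_comp
  exact (Set.finite_range U).subset (Set.range_comp_subset_range _ _)

/-- The sets that do not separate `ω` from `ω'` form a σ-algebra. If the two share the same past, it
contains the history, hence the level sets of `v`. -/
theorem dependsOnPast_of_measurable_history [MeasurableSpace E] {I : ℕ → Ω → Fin n} {k : ℕ}
    {u : ℕ → Ω → E} (hu : ∀ l ≤ k, DependsOnPast I k (u l)) {v : Ω → ℝ}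
    (hv : Measurable[history u k] v) : DependsOnPast I k v := by
  intro ω ω' h
  let m : MeasurableSpace Ω :=
    { MeasurableSet' := fun s => ω ∈ s ↔ ω' ∈ s
      measurableSet_empty := Iff.rfl
      measurableSet_compl := fun s hs => not_congr hs
      measurableSet_iUnion := fun s hs => by simp only [Set.mem_iUnion, hs] }
  have hle : history u k ≤ m := by
    refine iSup_le fun l => ?_
    rintro _ ⟨s, -, rfl⟩
    change u l ω ∈ s ↔ u l ω' ∈ s
    rw [hu l (Nat.lt_succ_iff.1 l.2) ω ω' h]
  have h1 : ω ∈ v ⁻¹' {v ω} ↔ ω' ∈ v ⁻¹' {v ω} := hle _ (hv (measurableSet_singleton _))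
  exact (h1.1 rfl).symm

variable {m₀ : MeasurableSpace Ω} {μ : Measure Ω}

/-- The filtration whose `k`-th σ-algebra is generated by `I 0, …, I (k - 1)`. -/
def pastFiltration (I : ℕ → Ω → Fin n) (hI : ∀ k, Measurable (I k)) : Filtration ℕ m₀ where
  seq k := ⨆ l ∈ Set.Iio k, MeasurableSpace.comap (I l) inferInstance
  mono' _ _ hkl := biSup_mono fun _ hl => lt_of_lt_of_le hl hkl
  le' _ := iSup₂_le fun l _ => (hI l).comap_le

theorem DependsOnPast.measurable [MeasurableSpace E] {I : ℕ → Ω → Fin n}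
    (hI : ∀ k, Measurable (I k)) {k : ℕ} {u : Ω → E} (hu : DependsOnPast I k u) :
    Measurable[pastFiltration I hI k] u := by
  rcases isEmpty_or_nonempty Ω with h | h
  · intro s _
    rw [Set.eq_empty_of_isEmpty (u ⁻¹' s)]
    exact MeasurableSpace.measurableSet_empty _
  obtain ⟨U, rfl⟩ := hu.exists_eq_comp
  refine (measurable_of_finite U).comp ?_
  refine @measurable_pi_lambda _ _ _ (pastFiltration I hI k) _ _ fun l => ?_
  have h1 : MeasurableSpace.comap (I l) inferInstance ≤ pastFiltration I hI k :=
    le_iSup₂_of_le (f := fun l (_ : l ∈ Set.Iio k) => MeasurableSpace.comap (I l) inferInstance)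
      (l : ℕ) l.2 le_rfl
  exact (comap_measurable (I l)).mono h1 le_rfl

theorem DependsOnPast.integrable [IsFiniteMeasure μ] {I : ℕ → Ω → Fin n}
    (hI : ∀ k, Measurable (I k)) {k : ℕ} {u : Ω → ℝ} (hu : DependsOnPast I k u) :
    Integrable u μ := by
  rcases isEmpty_or_nonempty Ω with h | h
  · simp [Measure.eq_zero_of_isEmpty μ]
  obtain ⟨C, hC⟩ := hu.finite_range.isBounded.exists_norm_le
  exact Integrable.of_bound
    ((hu.measurable hI).mono ((pastFiltration I hI).le k) le_rfl).aestronglyMeasurable C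
    (Eventually.of_forall fun ω => hC _ ⟨ω, rfl⟩)

/-- Splitting over the value of `I k`: each `φ i` is known from the past, and the indicator of `I k
= i` is independent of it. -/
theorem condExp_apply_index [IsProbabilityMeasure μ] {I : ℕ → Ω → Fin n}
    (hI : ∀ k, Measurable (I k)) (hIindep : iIndepFun I μ) {p : Fin n → ℝ} (hp : ∀ i, 0 < p i)
    (hIlaw : ∀ k i, μ {ω | I k ω = i} = ENNReal.ofReal (p i)) {k : ℕ} {φ : Fin n → Ω → ℝ}
    (hφ : ∀ i, DependsOnPast I k (φ i)) :
    μ[fun ω => φ (I k ω) ω | pastFiltration I hI k] =ᵐ[μ] fun ω => ∑ i, p i * φ i ω := by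
  have hset : ∀ i, MeasurableSet {ω | I k ω = i} := fun i => hI k (measurableSet_singleton i)
  have h1 : (fun ω => φ (I k ω) ω) = ∑ i, φ i * {ω | I k ω = i}.indicator 1 := by
    ext ω
    rw [Finset.sum_apply, Finset.sum_eq_single (I k ω)]
    · simp
    · intro i _ hi
      simp [Ne.symm hi]
    · simp
  have hind : Indep (MeasurableSpace.comap (I k) inferInstance) (pastFiltration I hI k) μ := by
    have h2 := indep_iSup_of_disjoint (fun l => (hI l).comap_le) hIindep
      (S := {k}) (T := Set.Iio k) (by simp)
    rw [iSup_singleton] at h2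
    exact h2
  have hone : ∀ i, Integrable ({ω | I k ω = i}.indicator (1 : Ω → ℝ)) μ := fun i =>
    (integrable_const (1 : ℝ)).indicator (hset i)
  have hint : ∀ i, Integrable (φ i * {ω | I k ω = i}.indicator 1) μ := by
    intro i
    have h3 : φ i * {ω | I k ω = i}.indicator 1 = {ω | I k ω = i}.indicator (φ i) := by
      ext ω
      by_cases h : I k ω = i <;> simp [h]
    rw [h3]
    exact ((hφ i).integrable hI).indicator (hset i)
  have h4 : ∀ i, μ[φ i * {ω | I k ω = i}.indicator 1 | pastFiltration I hI k]
      =ᵐ[μ] fun ω => p i * φ i ω := by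
    intro i
    have h5 : μ[{ω | I k ω = i}.indicator (1 : Ω → ℝ) | pastFiltration I hI k]
        =ᵐ[μ] fun _ => p i := by
      refine (condExp_indep_eq (hI k).comap_le ((pastFiltration I hI).le k) ?_ hind).trans ?_
      · refine StronglyMeasurable.indicator stronglyMeasurable_one ?_
        exact ⟨{i}, measurableSet_singleton i, rfl⟩
      · rw [integral_indicator_one (hset i), measureReal_def, hIlaw,
          ENNReal.toReal_ofReal (hp i).le]
    filter_upwards [condExp_mul_of_stronglyMeasurable_left
      ((hφ i).measurable hI).stronglyMeasurable (hint i) (hone i), h5] with ω h6 h7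
    rw [h6, Pi.mul_apply, h7, mul_comm]
  rw [h1]
  refine (condExp_finsetSum (fun i _ => hint i) _).trans ?_
  have h5 := ae_all_iff.2 h4
  filter_upwards [h5] with ω h6
  rw [Finset.sum_apply]
  exact Finset.sum_congr rfl fun i _ => h6 i

theorem sum_eq_one_of_law [IsProbabilityMeasure μ] {J : Ω → Fin n} (hJ : Measurable J)
    {p : Fin n → ℝ} (hp : ∀ i, 0 < p i) (hlaw : ∀ i, μ {ω | J ω = i} = ENNReal.ofReal (p i)) :
    ∑ i, p i = 1 := by
  have h1 : ∑ i, μ (J ⁻¹' {i}) = μ (J ⁻¹' (Finset.univ : Finset (Fin n))) :=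
    sum_measure_preimage_singleton _ fun i _ => hJ (measurableSet_singleton i)
  have h2 : ∀ i, μ (J ⁻¹' {i}) = ENNReal.ofReal (p i) := hlaw
  simp only [h2, Finset.coe_univ, Set.preimage_univ, measure_univ] at h1
  rw [← ENNReal.ofReal_sum_of_nonneg fun i _ => (hp i).le] at h1
  have h3 := ENNReal.ofReal_eq_one.1 h1
  exact h3

end Past

/-! ### Weak convergence along ultrafilters. -/

section Weak

variable {H : Type*} [NormedAddCommGroup H] [InnerProductSpace ℝ H] {ι : Type*}

/-- Weak convergence in an inner product space, tested against inner products. -/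
def TendstoWeakly (u : ι → H) (l : Filter ι) (u' : H) : Prop :=
  ∀ v, Tendsto (fun k => ⟪v, u k⟫_ℝ) l (𝓝 ⟪v, u'⟫_ℝ)

theorem TendstoWeakly.of_sub_tendsto_zero {u w : ι → H} {l : Filter ι} {u' : H}
    (hu : TendstoWeakly u l u') (hw : Tendsto (fun k => w k - u k) l (𝓝 0)) :
    TendstoWeakly w l u' := by
  intro v
  have h1 : Tendsto (fun k => ⟪v, w k - u k⟫_ℝ) l (𝓝 ⟪v, 0⟫_ℝ) := tendsto_const_nhds.inner hw
  refine ((hu v).add h1).congr' (Eventually.of_forall fun k => ?_) |>.trans (by simp)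
  rw [← inner_add_right, add_sub_cancel]

/-- Banach-Alaoglu, transported by the Riesz isomorphism; ultrafilters replace the extraction of
subsequences. -/
theorem TendstoWeakly.exists_of_bounded [CompleteSpace H] (U : Ultrafilter ι) {u : ι → H} {C : ℝ}
    (hu : ∀ k, ‖u k‖ ≤ C) : ∃ u', TendstoWeakly u U u' := by
  set F : ι → WeakDual ℝ H := fun k => StrongDual.toWeakDual (InnerProductSpace.toDual ℝ H (u k))
  have hcomp := WeakDual.isCompact_closedBall (𝕜 := ℝ) (0 : StrongDual ℝ H) C
  obtain ⟨φ, -, hφ⟩ := hcomp.ultrafilter_le_nhds (U.map F) (by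
    rw [Ultrafilter.coe_map, le_principal_iff, mem_map]
    refine univ_mem' fun k => ?_
    simpa [F] using hu k)
  refine ⟨(InnerProductSpace.toDual ℝ H).symm (WeakDual.toStrongDual φ), fun v => ?_⟩
  have h1 : Tendsto (fun k => F k v) U (𝓝 (φ v)) :=
    ((WeakDual.eval_continuous v).tendsto φ).comp hφ
  rw [real_inner_comm, InnerProductSpace.toDual_symm_apply]
  refine h1.congr fun k => ?_
  rw [real_inner_comm]
  rfl

theorem tendsto_inner_zero_of_bounded {a b : ι → H} {l : Filter ι} {C : ℝ} (ha : ∀ k, ‖a k‖ ≤ C)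
    (hb : Tendsto b l (𝓝 0)) : Tendsto (fun k => ⟪a k, b k⟫_ℝ) l (𝓝 0) := by
  refine squeeze_zero_norm (a := fun k => C * ‖b k‖) (fun k => ?_) ?_
  · exact (norm_inner_le_norm _ _).trans (by gcongr; exact ha k)
  · simpa using hb.norm.const_mul C

theorem exists_tendsto_of_abs_le (U : Ultrafilter ι) {r : ι → ℝ} {C : ℝ} (hr : ∀ k, |r k| ≤ C) :
    ∃ ρ, Tendsto r U (𝓝 ρ) := by
  obtain ⟨ρ, -, hρ⟩ := (isCompact_Icc (a := -C) (b := C)).ultrafilter_le_nhds (U.map r) (by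
    rw [Ultrafilter.coe_map, le_principal_iff, mem_map]
    exact univ_mem' fun k => abs_le.1 (hr k))
  exact ⟨ρ, hρ⟩

end Weak

/-! ### Weak cluster points of a single realization. -/

section Path

set_option linter.unusedSectionVars false

variable {n : ℕ} {X : Type*} {Y : Fin n → Type*}
  [NormedAddCommGroup X] [InnerProductSpace ℝ X] [CompleteSpace X]
  [∀ i, NormedAddCommGroup (Y i)] [∀ i, InnerProductSpace ℝ (Y i)] [∀ i, CompleteSpace (Y i)]
  {A : ∀ i, X →L[ℝ] Y i} {f : ∀ i, Y i → EReal} {g : X → EReal} {p : Fin n → ℝ}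

/-- The obstacle is that `⟪A i x, y i⟫` is not weakly continuous. The subgradient inequalities are
passed to the limit with unknown limits `ρ i` of these products, and testing them at the limit point
itself identifies `ρ i`. -/
theorem mem_saddlePoints_of_weak_limit (hf : ∀ i, IsProperConvexLSC (f i))
    (hg : IsProperConvexLSC g) {S : ℕ → State X Y} {τ : ℕ → ℝ} {σ : ℕ → Fin n → ℝ} {c C : ℝ}
    (hc : 0 < c) (hτ : ∀ k, c ≤ τ k) (hσ : ∀ k i, c ≤ σ k i) (hx : ∀ k, ‖(S k).x‖ ≤ C)
    (hy : ∀ k i, ‖(S k).y i‖ ≤ C)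
    (hdx : Tendsto (fun k => xNext A g (τ k) (S k) - (S k).x) atTop (𝓝 0))
    (hdy : ∀ i, Tendsto (fun k => yNext A f g (τ k) (σ k) (S k) i - (S k).y i) atTop (𝓝 0))
    (he : ∀ i, Tendsto (fun k => (S k).ybar i - (S k).y i) atTop (𝓝 0))
    {U : Ultrafilter ℕ} (hU : (U : Filter ℕ) ≤ atTop) {z : X × ∀ i, Y i}
    (hzx : TendstoWeakly (fun k => (S k).x) U z.1)
    (hzy : ∀ i, TendstoWeakly (fun k => (S k).y i) U (z.2 i)) :
    z ∈ saddlePoints A f g := by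
  set x' : ℕ → X := fun k => xNext A g (τ k) (S k) with hx'
  set y' : ∀ i, ℕ → Y i := fun i k => yNext A f g (τ k) (σ k) (S k) i with hy'
  obtain ⟨B, hB⟩ : ∃ B, ∀ k, ‖x' k‖ ≤ B := by
    obtain ⟨B, hB⟩ := hdx.norm.bddAbove_range
    refine ⟨B + C, fun k => ?_⟩
    calc ‖x' k‖ = ‖(x' k - (S k).x) + (S k).x‖ := by rw [sub_add_cancel]
      _ ≤ _ := (norm_add_le _ _).trans (add_le_add (hB ⟨k, rfl⟩) (hx k))
  have hB' : ∀ i, ∃ B, ∀ k, ‖y' i k‖ ≤ B := by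
    intro i
    obtain ⟨B, hB⟩ := (hdy i).norm.bddAbove_range
    refine ⟨B + C, fun k => ?_⟩
    calc ‖y' i k‖ = ‖(y' i k - (S k).y i) + (S k).y i‖ := by rw [sub_add_cancel]
      _ ≤ _ := (norm_add_le _ _).trans (add_le_add (hB ⟨k, rfl⟩) (hy k i))
  choose B' hB' using hB'
  have hAx : ∀ i k, ‖A i (x' k)‖ ≤ ‖A i‖ * B := fun i k =>
    ((A i).le_opNorm _).trans (by gcongr; exact hB k)
  have hwx : TendstoWeakly x' U z.1 := hzx.of_sub_tendsto_zero (hdx.mono_left hU)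
  have hwy : ∀ i, TendstoWeakly (y' i) U (z.2 i) := fun i =>
    (hzy i).of_sub_tendsto_zero ((hdy i).mono_left hU)
  have hwyb : ∀ i, TendstoWeakly (fun k => (S k).ybar i) U (z.2 i) := fun i =>
    (hzy i).of_sub_tendsto_zero ((he i).mono_left hU)
  have hρ : ∀ i, ∃ ρ, Tendsto (fun k => ⟪A i (x' k), y' i k⟫_ℝ) U (𝓝 ρ) := fun i =>
    exists_tendsto_of_abs_le U (C := ‖A i‖ * B * B' i) fun k =>
      (abs_real_inner_le_norm _ _).trans
        (mul_le_mul (hAx i k) (hB' i k) (norm_nonneg _) ((norm_nonneg _).trans (hAx i k)))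
  choose ρ hρ using hρ
  -- The primal inequality involves `ybar`, the dual one `y'`; their difference vanishes, so both
  -- produce the same `ρ i`.
  have hρ' : ∀ i, Tendsto (fun k => ⟪A i (x' k), (S k).ybar i⟫_ℝ) U (𝓝 (ρ i)) := by
    intro i
    have h1 : Tendsto (fun k => ((S k).ybar i - (S k).y i) - (y' i k - (S k).y i)) U (𝓝 0) := by
      simpa using ((he i).sub (hdy i)).mono_left hU
    have h2 := (hρ i).add (tendsto_inner_zero_of_bounded (hAx i) h1)
    rw [add_zero] at h2
    refine h2.congr fun k => ?_
    rw [← inner_add_right]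
    congr 1
    abel
  have hinv : ∀ {r : ℝ}, c ≤ r → ‖r⁻¹‖ ≤ c⁻¹ := fun {r} hr => by
    rw [Real.norm_of_nonneg (inv_nonneg.2 (hc.le.trans hr))]
    exact inv_anti₀ hc hr
  have hxz : Tendsto (fun k => (τ k)⁻¹ • ((S k).x - x' k)) U (𝓝 0) := by
    refine squeeze_zero_norm (a := fun k => c⁻¹ * ‖x' k - (S k).x‖) (fun k => ?_) ?_
    · rw [norm_smul, norm_sub_rev]
      gcongr
      exact hinv (hτ k)
    · simpa using (hdx.mono_left hU).norm.const_mul c⁻¹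
  have hyz : ∀ i, Tendsto (fun k => (σ k i)⁻¹ • ((S k).y i - y' i k)) U (𝓝 0) := by
    intro i
    refine squeeze_zero_norm (a := fun k => c⁻¹ * ‖y' i k - (S k).y i‖) (fun k => ?_) ?_
    · rw [norm_smul, norm_sub_rev]
      gcongr
      exact hinv (hσ k i)
    · simpa using ((hdy i).mono_left hU).norm.const_mul c⁻¹
  have hG : ∀ u s, g u = ((s : ℝ) : EReal) →
      g z.1 ≤ ((s + ∑ j, (⟪A j u, z.2 j⟫_ℝ - ρ j) : ℝ) : EReal) := by
    intro u s hs
    refine hg.le_of_tendsto_weakly hwx (c := fun k => s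
      - ⟪u - x' k, (τ k)⁻¹ • ((S k).x - x' k)⟫_ℝ
      + ∑ j, (⟪A j u, (S k).ybar j⟫_ℝ - ⟪A j (x' k), (S k).ybar j⟫_ℝ)) ?_ fun k => ?_
    · have h1 : Tendsto (fun k => ⟪u - x' k, (τ k)⁻¹ • ((S k).x - x' k)⟫_ℝ) U (𝓝 0) :=
        tendsto_inner_zero_of_bounded (C := ‖u‖ + B)
          (fun k => (norm_sub_le _ _).trans (add_le_add_right (hB k) _)) hxz
      have h2 := ((tendsto_const_nhds (x := s)).sub h1).add
        (tendsto_finsetSum Finset.univ fun j _ => (hwyb j (A j u)).sub (hρ' j))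
      rw [sub_zero] at h2
      exact h2
    · obtain ⟨r, hr, h1⟩ := isSubgradient_xNext (A := A) hg (hc.trans_le (hτ k)) (S k)
      have h2 := h1 u
      rw [hs, EReal.coe_le_coe_iff, inner_sub_left, inner_sum_adjoint, real_inner_comm] at h2
      rw [hx', hr, EReal.coe_le_coe_iff]
      simp only [map_sub, inner_sub_left, Finset.sum_sub_distrib] at h2 ⊢
      linarith
  have hF : ∀ j v s, conj (f j) v = ((s : ℝ) : EReal) →
      conj (f j) (z.2 j) ≤ ((s - ⟪A j z.1, v⟫_ℝ + ρ j : ℝ) : EReal) := by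
    intro j v s hs
    refine (hf j).conj.le_of_tendsto_weakly (hwy j) (c := fun k => s
      - ⟪A j (x' k), v⟫_ℝ + ⟪A j (x' k), y' j k⟫_ℝ
      - ⟪v - y' j k, (σ k j)⁻¹ • ((S k).y j - y' j k)⟫_ℝ) ?_ fun k => ?_
    · have h1 : Tendsto (fun k => ⟪v - y' j k, (σ k j)⁻¹ • ((S k).y j - y' j k)⟫_ℝ) U (𝓝 0) :=
        tendsto_inner_zero_of_bounded (C := ‖v‖ + B' j)
          (fun k => (norm_sub_le _ _).trans (add_le_add_right (hB' j k) _)) (hyz j)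
      have h3 : Tendsto (fun k => ⟪A j (x' k), v⟫_ℝ) U (𝓝 ⟪A j z.1, v⟫_ℝ) := by
        have h4 := hwx (ContinuousLinearMap.adjoint (A j) v)
        simp only [ContinuousLinearMap.adjoint_inner_left] at h4
        simpa only [real_inner_comm] using h4
      have h2 := (((tendsto_const_nhds (x := s)).sub h3).add (hρ j)).sub h1
      rw [sub_zero] at h2
      exact h2
    · obtain ⟨r, hr, h1⟩ := isSubgradient_yNext (A := A) (g := g) (t := τ k) hf
        (fun i => hc.trans_le (hσ k i)) (S k) j
      have h2 := h1 v
      rw [hs, EReal.coe_le_coe_iff, inner_add_left, real_inner_comm] at h2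
      rw [hy', hr, EReal.coe_le_coe_iff]
      simp only [inner_sub_right (A j (xNext A g (τ k) (S k)))] at h2 ⊢
      linarith
  obtain ⟨u₀, hu₀⟩ := hg.exists_ne_top
  obtain ⟨s₀, hs₀⟩ := hg.exists_eq_coe hu₀
  obtain ⟨r, hr⟩ := hg.exists_eq_coe (ne_top_of_le_ne_top (EReal.coe_ne_top _) (hG u₀ s₀ hs₀))
  have hfin : ∀ j, ∃ r : ℝ, conj (f j) (z.2 j) = r := by
    intro j
    obtain ⟨v₀, hv₀⟩ := (hf j).conj.exists_ne_top
    obtain ⟨s₀, hs₀⟩ := (hf j).conj.exists_eq_coe hv₀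
    exact (hf j).conj.exists_eq_coe (ne_top_of_le_ne_top (EReal.coe_ne_top _) (hF j v₀ s₀ hs₀))
  choose d hd using hfin
  -- The primal inequality at `u = z.1` bounds the sum of the defects from below, the dual ones at
  -- `v = z.2 j` bound each from above; so all defects are zero.
  have h1 : 0 ≤ ∑ j, (⟪A j z.1, z.2 j⟫_ℝ - ρ j) := by
    have h1 := hG z.1 r hr
    rw [hr, EReal.coe_le_coe_iff] at h1
    linarith
  have h2 : ∀ j, ⟪A j z.1, z.2 j⟫_ℝ - ρ j ≤ 0 := by
    intro j
    have h1 := hF j _ _ (hd j)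
    rw [hd, EReal.coe_le_coe_iff] at h1
    linarith
  have h3 : ∀ j, ⟪A j z.1, z.2 j⟫_ℝ - ρ j = 0 := fun j =>
    (Finset.sum_eq_zero_iff_of_nonpos fun j _ => h2 j).1
      (le_antisymm (Finset.sum_nonpos fun j _ => h2 j) h1) j (Finset.mem_univ j)
  have h4 : ∀ j, ρ j = ⟪A j z.1, z.2 j⟫_ℝ := fun j => by linarith [h3 j]
  rw [mem_saddlePoints_iff hf hg]
  refine ⟨⟨r, hr, fun u => ?_⟩, fun j => ⟨d j, hd j, fun v => ?_⟩⟩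
  · by_cases hu : g u = ⊤
    · simp [hu]
    obtain ⟨s, hs⟩ := hg.exists_eq_coe hu
    have h5 := hG u s hs
    rw [hr, EReal.coe_le_coe_iff] at h5
    rw [hs, EReal.coe_le_coe_iff, inner_neg_left, inner_sum_adjoint]
    simp only [map_sub, inner_sub_left, h4] at h5 ⊢
    linarith
  · by_cases hv : conj (f j) v = ⊤
    · simp [hv]
    obtain ⟨s, hs⟩ := (hf j).conj.exists_eq_coe hv
    have h5 := hF j v s hs
    rw [hd, EReal.coe_le_coe_iff, h4] at h5
    rw [hs, EReal.coe_le_coe_iff, inner_sub_right]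
    linarith

/-- Opial's argument: if the distances to the points of `D`, measured with weights that converge to
positive limits, converge, then weak cluster points in the closure of `D` are unique. -/
theorem weak_limit_unique {S : ℕ → State X Y} {a : ℕ → ℝ} {b : ℕ → Fin n → ℝ} {T : ℝ}
    {R : Fin n → ℝ} (hT : 0 < T) (hR : ∀ i, 0 < R i) (ha : Tendsto a atTop (𝓝 T))
    (hb : ∀ i, Tendsto (fun k => b k i) atTop (𝓝 (R i))) {D : Set (X × ∀ i, Y i)}
    (hD : ∀ d ∈ D, ∃ L, Tendsto (fun k => a k * ‖(S k).x - d.1‖ ^ 2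
      + ∑ i, b k i * ‖(S k).y i - d.2 i‖ ^ 2) atTop (𝓝 L))
    {U U' : Ultrafilter ℕ} (hU : (U : Filter ℕ) ≤ atTop) (hU' : (U' : Filter ℕ) ≤ atTop)
    {z z' : X × ∀ i, Y i} (hz : z ∈ closure D) (hz' : z' ∈ closure D)
    (hzx : TendstoWeakly (fun k => (S k).x) U z.1)
    (hzy : ∀ i, TendstoWeakly (fun k => (S k).y i) U (z.2 i))
    (hzx' : TendstoWeakly (fun k => (S k).x) U' z'.1)
    (hzy' : ∀ i, TendstoWeakly (fun k => (S k).y i) U' (z'.2 i)) : z = z' := by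
  set B : (X × ∀ i, Y i) → ℝ := fun d =>
    T * ⟪d.1, z.1 - z'.1⟫_ℝ + ∑ i, R i * ⟪d.2 i, z.2 i - z'.2 i⟫_ℝ with hBdef
  -- In a difference of two squared distances the terms `‖(S k).x‖ ^ 2` and `‖(S k).y i‖ ^ 2`
  -- cancel, and what remains is affine in the iterates, hence has a limit along `V`.
  have hlim : ∀ (V : Ultrafilter ℕ) (w : X × ∀ i, Y i), (V : Filter ℕ) ≤ atTop →
      TendstoWeakly (fun k => (S k).x) V w.1 → (∀ i, TendstoWeakly (fun k => (S k).y i) V (w.2 i)) →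
      ∀ d d' : X × ∀ i, Y i, Tendsto (fun k => (a k * ‖(S k).x - d.1‖ ^ 2
        + ∑ i, b k i * ‖(S k).y i - d.2 i‖ ^ 2) - (a k * ‖(S k).x - d'.1‖ ^ 2
        + ∑ i, b k i * ‖(S k).y i - d'.2 i‖ ^ 2)) V
        (𝓝 (T * (2 * (⟪d'.1, w.1⟫_ℝ - ⟪d.1, w.1⟫_ℝ) + (‖d.1‖ ^ 2 - ‖d'.1‖ ^ 2))
          + ∑ i, R i * (2 * (⟪d'.2 i, w.2 i⟫_ℝ - ⟪d.2 i, w.2 i⟫_ℝ)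
            + (‖d.2 i‖ ^ 2 - ‖d'.2 i‖ ^ 2)))) := by
    intro V w hV hwx hwy d d'
    have h1 := ((ha.mono_left hV).mul ((((hwx d'.1).sub (hwx d.1)).const_mul 2).add_const
      (‖d.1‖ ^ 2 - ‖d'.1‖ ^ 2))).add (tendsto_finsetSum Finset.univ fun i _ =>
        ((hb i).mono_left hV).mul ((((hwy i (d'.2 i)).sub (hwy i (d.2 i))).const_mul 2).add_const
          (‖d.2 i‖ ^ 2 - ‖d'.2 i‖ ^ 2)))
    refine h1.congr fun k => ?_
    rw [add_sub_add_comm, ← Finset.sum_sub_distrib]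
    congr 1
    · rw [norm_sub_sq_real, norm_sub_sq_real, real_inner_comm d.1, real_inner_comm d'.1]
      ring
    · refine Finset.sum_congr rfl fun i _ => ?_
      rw [norm_sub_sq_real, norm_sub_sq_real, real_inner_comm (d.2 i), real_inner_comm (d'.2 i)]
      ring
  have hBeq : ∀ d ∈ D, ∀ d' ∈ D, B d = B d' := by
    intro d hd d' hd'
    obtain ⟨L, hL⟩ := hD d hd
    obtain ⟨L', hL'⟩ := hD d' hd'
    have h1 := tendsto_nhds_unique (hlim U z hU hzx hzy d d') ((hL.sub hL').mono_left hU)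
    have h2 := tendsto_nhds_unique (hlim U' z' hU' hzx' hzy' d d') ((hL.sub hL').mono_left hU')
    have h3 := h1.trans h2.symm
    simp only [mul_add, mul_sub, Finset.sum_add_distrib, Finset.sum_sub_distrib] at h3
    simp only [hBdef, inner_sub_right, mul_sub, Finset.sum_sub_distrib]
    simp only [mul_left_comm _ (2 : ℝ), ← Finset.mul_sum] at h3
    linarith
  have hBcont : Continuous B := by
    simp only [hBdef]
    fun_prop
  -- By continuity `B` is constant on the closure, which contains `z` and `z'`; there `B z - B z'`
  -- is a weighted squared distance.
  have hBcl : ∀ d ∈ closure D, ∀ d' ∈ closure D, B d = B d' := by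
    have h1 : ∀ d ∈ D, ∀ d' ∈ closure D, B d = B d' := fun d hd d' hd' =>
      closure_minimal (fun w hw => hBeq d hd w hw)
        (isClosed_eq continuous_const hBcont) hd'
    exact fun d hd d' hd' => closure_minimal (fun w hw => h1 w hw d' hd')
        (isClosed_eq hBcont continuous_const) hd
  have h0 : T * ‖z.1 - z'.1‖ ^ 2 + ∑ i, R i * ‖z.2 i - z'.2 i‖ ^ 2 = 0 := by
    have h1 := hBcl z hz z' hz'
    rw [← sub_eq_zero] at h1
    simp only [hBdef] at h1
    rw [add_sub_add_comm, ← Finset.sum_sub_distrib, ← mul_sub, ← inner_sub_left] at h1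
    simp only [← mul_sub, ← inner_sub_left, real_inner_self_eq_norm_sq] at h1
    exact h1
  have hn1 : 0 ≤ T * ‖z.1 - z'.1‖ ^ 2 := by positivity
  have hn2 : ∀ i ∈ Finset.univ, 0 ≤ R i * ‖z.2 i - z'.2 i‖ ^ 2 := fun i _ => by
    have := hR i
    positivity
  have h1 := (add_eq_zero_iff_of_nonneg hn1 (Finset.sum_nonneg hn2)).1 h0
  have h2 := (Finset.sum_eq_zero_iff_of_nonneg hn2).1 h1.2
  refine Prod.ext ?_ (funext fun i => ?_)
  · simpa [hT.ne', sub_eq_zero] using h1.1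
  · simpa [(hR i).ne', sub_eq_zero] using h2 i (Finset.mem_univ i)

theorem exists_weak_limit_mem_saddlePoints (hf : ∀ i, IsProperConvexLSC (f i))
    (hg : IsProperConvexLSC g) {S : ℕ → State X Y} {τ : ℕ → ℝ} {σ : ℕ → Fin n → ℝ} {c C : ℝ}
    (hc : 0 < c) (hτ : ∀ k, c ≤ τ k) (hσ : ∀ k i, c ≤ σ k i) (hx : ∀ k, ‖(S k).x‖ ≤ C)
    (hy : ∀ k i, ‖(S k).y i‖ ≤ C)
    (hdx : Tendsto (fun k => xNext A g (τ k) (S k) - (S k).x) atTop (𝓝 0))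
    (hdy : ∀ i, Tendsto (fun k => yNext A f g (τ k) (σ k) (S k) i - (S k).y i) atTop (𝓝 0))
    (he : ∀ i, Tendsto (fun k => (S k).ybar i - (S k).y i) atTop (𝓝 0))
    {a : ℕ → ℝ} {b : ℕ → Fin n → ℝ} {T : ℝ}
    {R : Fin n → ℝ} (hT : 0 < T) (hR : ∀ i, 0 < R i) (ha : Tendsto a atTop (𝓝 T))
    (hb : ∀ i, Tendsto (fun k => b k i) atTop (𝓝 (R i))) {D : Set (X × ∀ i, Y i)}
    (hDC : saddlePoints A f g ⊆ closure D)
    (hD : ∀ d ∈ D, ∃ L, Tendsto (fun k => a k * ‖(S k).x - d.1‖ ^ 2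
      + ∑ i, b k i * ‖(S k).y i - d.2 i‖ ^ 2) atTop (𝓝 L)) :
    ∃ z ∈ saddlePoints A f g, TendstoWeakly (fun k => (S k).x) atTop z.1 ∧
      ∀ i, TendstoWeakly (fun k => (S k).y i) atTop (z.2 i) := by
  have hex : ∀ U : Ultrafilter ℕ, (U : Filter ℕ) ≤ atTop → ∃ z ∈ saddlePoints A f g,
      TendstoWeakly (fun k => (S k).x) U z.1 ∧
      ∀ i, TendstoWeakly (fun k => (S k).y i) U (z.2 i) := by
    intro U hU
    obtain ⟨x, hxU⟩ := TendstoWeakly.exists_of_bounded U hx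
    choose y hyU using fun i => TendstoWeakly.exists_of_bounded U fun k => hy k i
    exact ⟨(x, y), mem_saddlePoints_of_weak_limit hf hg hc hτ hσ hx hy hdx hdy he hU hxU hyU,
      hxU, hyU⟩
  obtain ⟨z, hz, hzx, hzy⟩ := hex (Ultrafilter.of atTop) (Ultrafilter.of_le _)
  have huniq : ∀ U : Ultrafilter ℕ, (U : Filter ℕ) ≤ atTop →
      TendstoWeakly (fun k => (S k).x) U z.1 ∧
      ∀ i, TendstoWeakly (fun k => (S k).y i) U (z.2 i) := by
    intro U hU
    obtain ⟨z', hz', hzx', hzy'⟩ := hex U hU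
    obtain rfl := weak_limit_unique hT hR ha hb hD hU (Ultrafilter.of_le _) (hDC hz') (hDC hz)
      hzx' hzy' hzx hzy
    exact ⟨hzx', hzy'⟩
  exact ⟨z, hz, fun v => (tendsto_iff_ultrafilter _ _ _).2 fun U hU => (huniq U hU).1 v,
    fun i v => (tendsto_iff_ultrafilter _ _ _).2 fun U hU => (huniq U hU).2 i v⟩

end Path

/-! ### Quasi-monotone real sequences. -/

section Sequences

/-- Divided by the convergent products of the `1 + δ j`, the sequence decreases. -/
theorem exists_tendsto_of_le_one_add_mul {a δ : ℕ → ℝ} (ha : ∀ k, 0 < a k) (hδ : ∀ k, 0 ≤ δ k)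
    (hδs : Summable δ) (h : ∀ k, a (k + 1) ≤ (1 + δ k) * a k) :
    ∃ L, Tendsto a atTop (𝓝 L) := by
  set P : ℕ → ℝ := fun k => ∏ j ∈ Finset.range k, (1 + δ j) with hP
  have hPpos : ∀ k, 0 < P k := fun k => Finset.prod_pos fun j _ => by linarith [hδ j]
  have hPsucc : ∀ k, P (k + 1) = P k * (1 + δ k) := fun k => Finset.prod_range_succ _ _
  have hanti : Antitone fun k => a k / P k := by
    refine antitone_nat_of_succ_le fun k => ?_
    have h1 := hPpos k
    have h2 := hPpos (k + 1)
    have h3 : (0 : ℝ) < 1 + δ k := by linarith [hδ k]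
    rw [div_le_div_iff₀ h2 h1, hPsucc]
    calc a (k + 1) * P k ≤ (1 + δ k) * a k * P k := by gcongr; exact h k
      _ = _ := by ring
  have hlim := tendsto_atTop_ciInf hanti
    ⟨0, by rintro _ ⟨k, rfl⟩; exact div_nonneg (ha k).le (hPpos k).le⟩
  refine ⟨_, (hlim.mul
    (Real.multipliable_one_add_of_summable hδs).hasProd.tendsto_prod_nat).congr fun k => ?_⟩
  exact div_mul_cancel₀ _ (hPpos k).ne'

theorem UniformlyQuasiIncreasing.exists_one_div_le {Ω : Type*} [MeasurableSpace Ω] {μ : Measure Ω}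
    {u : ℕ → Ω → ℝ} (hu : UniformlyQuasiIncreasing μ u) :
    ∃ δ : ℕ → ℝ, (∀ k, 0 ≤ δ k) ∧ Summable δ ∧
      ∀ᵐ ω ∂μ, ∀ k, 1 / u (k + 1) ω ≤ (1 + δ k) * (1 / u k ω) := by
  obtain ⟨hpos, η, hη, hηs, hqi⟩ := hu
  -- `1 / (1 - η) = 1 + η / (1 - η)`, and the last term is at most `2 η` once `η ≤ 1 / 2`.
  refine ⟨fun k => η k / (1 - η k), fun k => div_nonneg (hη k).1 (by linarith [(hη k).2]), ?_, ?_⟩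
  · have h1 : ∀ᶠ k in atTop, η k ≤ 1 / 2 :=
      (hηs.tendsto_atTop_zero.eventually_lt_const (by norm_num : (0 : ℝ) < 1 / 2)).mono
        fun k hk => hk.le
    refine Summable.of_norm_bounded_eventually_nat (hηs.mul_left 2) ?_
    filter_upwards [h1] with k hk
    have h2 : 0 < 1 - η k := by linarith
    rw [Real.norm_of_nonneg (div_nonneg (hη k).1 h2.le), div_le_iff₀ h2]
    nlinarith [(hη k).1]
  · filter_upwards [hqi] with ω hω k
    have h1 : 0 < 1 - η k := by linarith [(hη k).2]
    have h2 := hpos k ω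
    have h3 : (1 + η k / (1 - η k)) * (1 / u k ω) = 1 / ((1 - η k) * u k ω) := by
      field_simp
      ring
    rw [h3]
    exact one_div_le_one_div_of_le (by positivity) (hω k)

variable {H : Type*} [NormedAddCommGroup H]

theorem tendsto_zero_of_mul_norm_sq {a : ℕ → ℝ} {v : ℕ → H} {T : ℝ} (hT : 0 < T)
    (ha : Tendsto a atTop (𝓝 T)) (ha' : ∀ k, 0 < a k)
    (hv : Tendsto (fun k => a k * ‖v k‖ ^ 2) atTop (𝓝 0)) : Tendsto v atTop (𝓝 0) := by
  rw [tendsto_zero_iff_norm_tendsto_zero]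
  have h1 := (hv.div ha hT.ne').sqrt
  rw [zero_div, Real.sqrt_zero] at h1
  refine h1.congr fun k => ?_
  rw [Pi.div_apply, mul_div_cancel_left₀ _ (ha' k).ne', Real.sqrt_sq (norm_nonneg _)]

theorem exists_norm_le_of_mul_norm_sq_le {a : ℕ → ℝ} {v : ℕ → H} {T M : ℝ} (hT : 0 < T)
    (ha : Tendsto a atTop (𝓝 T)) (ha' : ∀ k, 0 < a k) (hv : ∀ k, a k * ‖v k‖ ^ 2 ≤ M) :
    ∃ C, ∀ k, ‖v k‖ ≤ C := by
  obtain ⟨B, hB⟩ := ((tendsto_const_nhds (x := M)).div ha hT.ne').bddAbove_range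
  refine ⟨√B, fun k => Real.le_sqrt_of_sq_le (le_trans ?_ (hB ⟨k, rfl⟩))⟩
  rw [Pi.div_apply, le_div_iff₀ (ha' k), mul_comm]
  exact hv k

end Sequences

/-! ### From convergence of `lyap` to weak convergence of a realization. -/

section PathConvergence

set_option linter.unusedSectionVars false

variable {n : ℕ} {X : Type*} {Y : Fin n → Type*}
  [NormedAddCommGroup X] [InnerProductSpace ℝ X] [CompleteSpace X]
  [∀ i, NormedAddCommGroup (Y i)] [∀ i, InnerProductSpace ℝ (Y i)] [∀ i, CompleteSpace (Y i)]
  {A : ∀ i, X →L[ℝ] Y i} {f : ∀ i, Y i → EReal} {g : X → EReal} {p : Fin n → ℝ}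

theorem exists_lower_bound_steps {τ : ℕ → ℝ} {σ : ℕ → Fin n → ℝ} {δ : ℕ → ℝ}
    (hτ : ∀ k, 0 < τ k) (hσ : ∀ k i, 0 < σ k i) (hδ : ∀ k, 0 ≤ δ k) (hδs : Summable δ)
    (hτδ : ∀ k, 1 / τ (k + 1) ≤ (1 + δ k) * (1 / τ k))
    (hσδ : ∀ k i, 1 / σ (k + 1) i ≤ (1 + δ k) * (1 / σ k i)) :
    ∃ c > 0, (∀ k, c ≤ τ k) ∧ ∀ k i, c ≤ σ k i := by
  obtain ⟨L, hL⟩ := exists_tendsto_of_le_one_add_mul (fun k => one_div_pos.2 (hτ k)) hδ hδs hτδ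
  choose L' hL' using fun i =>
    exists_tendsto_of_le_one_add_mul (fun k => one_div_pos.2 (hσ k i)) hδ hδs fun k => hσδ k i
  obtain ⟨M, hM⟩ := (hL.add (tendsto_finsetSum Finset.univ fun i _ => hL' i)).bddAbove_range
  have hM' : ∀ k, 1 / τ k + ∑ i, 1 / σ k i ≤ M := fun k => hM ⟨k, rfl⟩
  have h1 : ∀ k i, 0 ≤ 1 / σ k i := fun k i => (one_div_pos.2 (hσ k i)).le
  have h2 : ∀ k, 0 ≤ ∑ i, 1 / σ k i := fun k => Finset.sum_nonneg fun i _ => h1 k i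
  have hMpos : 0 < M := by linarith [hM' 0, h2 0, one_div_pos.2 (hτ 0)]
  refine ⟨1 / M, one_div_pos.2 hMpos, fun k => ?_, fun k i => ?_⟩
  · rw [one_div_le hMpos (hτ k)]
    linarith [hM' k, h2 k]
  · rw [one_div_le hMpos (hσ k i)]
    have h3 : 1 / σ k i ≤ ∑ i, 1 / σ k i :=
      Finset.single_le_sum (fun i _ => h1 k i) (Finset.mem_univ i)
    linarith [hM' k, one_div_pos.2 (hτ k)]

/-- A coupled block has its dual step-size bounded below, so the product condition bounds the primal
one above. This keeps the limit of the weights positive. -/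
theorem exists_upper_bound_effPrimal {τ : ℕ → ℝ} {σ : ℕ → Fin n → ℝ} {c β : ℝ} (hc : 0 < c)
    (hτ : ∀ k, 0 < τ k) (hσc : ∀ k i, c ≤ σ k i)
    (hA : ∀ k i, ‖A i‖ ^ 2 * (effPrimal A (τ k) * effDual A (σ k) i) ≤ β * p i) :
    ∃ C > 0, ∀ k, effPrimal A (τ k) ≤ C := by
  by_cases h : ∀ i, A i = 0
  · exact ⟨1, one_pos, fun k => by rw [effPrimal, if_pos h]⟩
  have h' := h
  push Not at h
  obtain ⟨i, hi⟩ := h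
  have hn : 0 < ‖A i‖ ^ 2 := by have := norm_pos_iff.2 hi; positivity
  have hle : ∀ k, effPrimal A (τ k) ≤ β * p i / (‖A i‖ ^ 2 * c) := by
    intro k
    rw [le_div_iff₀ (by positivity)]
    refine le_trans ?_ (hA k i)
    have h1 : c ≤ effDual A (σ k) i := by
      rw [effDual, if_neg hi]
      exact hσc k i
    have h2 := (effPrimal_pos A (hτ k)).le
    calc effPrimal A (τ k) * (‖A i‖ ^ 2 * c) = ‖A i‖ ^ 2 * (effPrimal A (τ k) * c) := by ring
      _ ≤ _ := by gcongr
  exact ⟨_, (effPrimal_pos A (hτ 0)).trans_le (hle 0), hle⟩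

theorem exists_upper_bound_effDual {τ : ℕ → ℝ} {σ : ℕ → Fin n → ℝ} {c β : ℝ} (hc : 0 < c)
    (hτc : ∀ k, c ≤ τ k) (hσ : ∀ k i, 0 < σ k i)
    (hA : ∀ k i, ‖A i‖ ^ 2 * (effPrimal A (τ k) * effDual A (σ k) i) ≤ β * p i) (i : Fin n) :
    ∃ C > 0, ∀ k, effDual A (σ k) i ≤ C := by
  by_cases hi : A i = 0
  · exact ⟨1, one_pos, fun k => by rw [effDual, if_pos hi]⟩
  have h : ¬ ∀ i, A i = 0 := fun h => hi (h i)
  have hn : 0 < ‖A i‖ ^ 2 := by have := norm_pos_iff.2 hi; positivity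
  have hle : ∀ k, effDual A (σ k) i ≤ β * p i / (‖A i‖ ^ 2 * c) := by
    intro k
    rw [le_div_iff₀ (by positivity)]
    refine le_trans ?_ (hA k i)
    have h1 : c ≤ effPrimal A (τ k) := by
      rw [effPrimal, if_neg h]
      exact hτc k
    have h2 := (effDual_pos A (hσ k) i).le
    calc effDual A (σ k) i * (‖A i‖ ^ 2 * c) = ‖A i‖ ^ 2 * (c * effDual A (σ k) i) := by ring
      _ ≤ _ := by gcongr
  exact ⟨_, (effDual_pos A (hσ 0) i).trans_le (hle 0), hle⟩

/-- Convergence along a single realization of the algorithm. -/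
theorem exists_weak_limit_of_lyap_tendsto (hf : ∀ i, IsProperConvexLSC (f i))
    (hg : IsProperConvexLSC g) (hp : ∀ i, 0 < p i) {κ : ℝ} (hκ : 0 ≤ κ) (hκ' : κ < 1)
    {S : ℕ → State X Y} {τ : ℕ → ℝ} {σ : ℕ → Fin n → ℝ} {I : ℕ → Fin n}
    (hstep : ∀ k, S (k + 1) = step A f g p (τ k) (σ k) (I k) (S k))
    (hτ : ∀ k, 0 < τ k) (hσ : ∀ k i, 0 < σ k i)
    (hA : ∀ k i, ‖A i‖ ^ 2 * (effPrimal A (τ k) * effDual A (σ k) i) ≤ κ ^ 2 * p i)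
    (hS : ∀ k, ∃ i₀, ∀ j, j ≠ i₀ → (S k).ybar j = (S k).y j)
    {δ : ℕ → ℝ} (hδ : ∀ k, 0 ≤ δ k) (hδs : Summable δ)
    (hτδ : ∀ k, 1 / τ (k + 1) ≤ (1 + δ k) * (1 / τ k))
    (hσδ : ∀ k i, 1 / σ (k + 1) i ≤ (1 + δ k) * (1 / σ k i))
    {D : Set (X × ∀ i, Y i)} (hDne : D.Nonempty) (hDC : saddlePoints A f g ⊆ closure D)
    (hD : ∀ d ∈ D, ∃ L,
      Tendsto (fun k => lyap A p κ d (effPrimal A (τ k)) (effDual A (σ k)) (S k)) atTop (𝓝 L))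
    (hdrift : Summable fun k => drift A f g κ (τ k) (σ k) (S k)) :
    ∃ z ∈ saddlePoints A f g, TendstoWeakly (fun k => (S k).x) atTop z.1 ∧
      ∀ i, TendstoWeakly (fun k => (S k).y i) atTop (z.2 i) := by
  obtain ⟨c, hc, hcτ, hcσ⟩ := exists_lower_bound_steps hτ hσ hδ hδs hτδ hσδ
  have ht' := fun k => effPrimal_pos A (hτ k)
  have hs' := fun k => effDual_pos A (hσ k)
  set a : ℕ → ℝ := fun k => 1 / (2 * effPrimal A (τ k)) with ha_def
  set q : ℕ → Fin n → ℝ := fun k i => 1 / (2 * effDual A (σ k) i) with hq_def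
  set b : ℕ → Fin n → ℝ := fun k i => 1 / (2 * effDual A (σ k) i * p i) with hb_def
  have ha_pos : ∀ k, 0 < a k := fun k => by have := ht' k; positivity
  have hq_pos : ∀ k i, 0 < q k i := fun k i => by have := hs' k i; positivity
  have hb_pos : ∀ k i, 0 < b k i := fun k i => by have := hs' k i; have := hp i; positivity
  obtain ⟨T, hT, ha⟩ : ∃ T > 0, Tendsto a atTop (𝓝 T) := by
    obtain ⟨T, hT⟩ := exists_tendsto_of_le_one_add_mul ha_pos hδ hδs fun k => by
      have h1 := one_div_effPrimal_le A (hδ k) (hτδ k)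
      simp only [ha_def, one_div, mul_inv] at h1 ⊢
      linarith
    obtain ⟨C, hC, hC'⟩ := exists_upper_bound_effPrimal hc hτ hcσ hA
    refine ⟨T, lt_of_lt_of_le (b := 1 / (2 * C)) (by positivity) (ge_of_tendsto' hT fun k => ?_), hT⟩
    have h1 := hC' k
    have h2 := ht' k
    simp only [ha_def]
    gcongr
  have hq : ∀ i, ∃ R > 0, Tendsto (fun k => q k i) atTop (𝓝 R) := by
    intro i
    obtain ⟨R, hR⟩ := exists_tendsto_of_le_one_add_mul (fun k => hq_pos k i) hδ hδs fun k => by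
      have h1 := one_div_effDual_le A (hδ k) (hσδ k) i
      simp only [hq_def, one_div, mul_inv] at h1 ⊢
      linarith
    obtain ⟨C, hC, hC'⟩ := exists_upper_bound_effDual hc hcτ hσ hA i
    refine ⟨R, lt_of_lt_of_le (b := 1 / (2 * C)) (by positivity) (ge_of_tendsto' hR fun k => ?_), hR⟩
    have h1 := hC' k
    have h2 := hs' k i
    simp only [hq_def]
    gcongr
  choose R hR hq using hq
  have hb : ∀ i, Tendsto (fun k => b k i) atTop (𝓝 (R i / p i)) := by
    intro i
    refine ((hq i).div_const (p i)).congr fun k => ?_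
    simp only [hq_def, hb_def, div_div]
  have hd0 : Tendsto (fun k => 2 / (1 - κ) * drift A f g κ (τ k) (σ k) (S k)) atTop (𝓝 0) := by
    simpa using hdrift.tendsto_atTop_zero.const_mul (2 / (1 - κ))
  have hd_eq : ∀ k, 2 / (1 - κ) * drift A f g κ (τ k) (σ k) (S k)
      = a k * ‖xNext A g (τ k) (S k) - (S k).x‖ ^ 2
        + ∑ j, q k j * ‖yNext A f g (τ k) (σ k) (S k) j - (S k).y j‖ ^ 2 := by
    intro k
    have h1 : (1 - κ) ≠ 0 := by linarith
    simp only [drift, ha_def, hq_def, one_div_mul_eq_div]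
    field_simp
  have hn1 : ∀ k, 0 ≤ a k * ‖xNext A g (τ k) (S k) - (S k).x‖ ^ 2 := fun k => by
    have := ha_pos k; positivity
  have hn2 : ∀ k j, 0 ≤ q k j * ‖yNext A f g (τ k) (σ k) (S k) j - (S k).y j‖ ^ 2 := fun k j => by
    have := hq_pos k j; positivity
  have hdx : Tendsto (fun k => xNext A g (τ k) (S k) - (S k).x) atTop (𝓝 0) := by
    refine tendsto_zero_of_mul_norm_sq hT ha ha_pos (squeeze_zero hn1 (fun k => ?_) hd0)
    rw [hd_eq]
    exact le_add_of_nonneg_right (Finset.sum_nonneg fun j _ => hn2 k j)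
  have hdy : ∀ i, Tendsto (fun k => yNext A f g (τ k) (σ k) (S k) i - (S k).y i) atTop (𝓝 0) := by
    intro i
    refine tendsto_zero_of_mul_norm_sq (hR i) (hq i) (fun k => hq_pos k i)
      (squeeze_zero (fun k => hn2 k i) (fun k => ?_) hd0)
    rw [hd_eq]
    exact (Finset.single_le_sum (fun j _ => hn2 k j) (Finset.mem_univ i)).trans
      (le_add_of_nonneg_left (hn1 k))
  have he : ∀ i, Tendsto (fun k => (S k).ybar i - (S k).y i) atTop (𝓝 0) := by
    intro i
    -- The extrapolation after iteration `k` is zero or `1 / p i` times the increment of that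
    -- iteration.
    rw [← tendsto_add_atTop_iff_nat 1]
    refine squeeze_zero_norm (a := fun k => ‖(1 / p i) •
      (yNext A f g (τ k) (σ k) (S k) i - (S k).y i)‖) (fun k => ?_) ?_
    · rw [hstep k, step_ybar_sub_y]
      split_ifs
      · exact le_rfl
      · simp
    · simpa using ((hdy i).const_smul (1 / p i)).norm
  obtain ⟨d₀, hd₀⟩ := hDne
  have hbound : ∃ M, ∀ k, quad p κ d₀ (effPrimal A (τ k)) (effDual A (σ k)) (S k) ≤ M := by
    obtain ⟨L, hL⟩ := hD d₀ hd₀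
    obtain ⟨B, hB⟩ := hL.bddAbove_range
    refine ⟨2 / (1 - κ) * B, fun k => ?_⟩
    obtain ⟨i₀, hi₀⟩ := hS k
    have h1 := mul_quad_le_lyap hκ hκ' (ht' k) (hs' k) hp (hA k) d₀ hi₀
    have h2 := h1.trans (hB ⟨k, rfl⟩)
    have h3 : 0 < 1 - κ := by linarith
    rw [div_mul_eq_mul_div, le_div_iff₀ h3]
    linarith
  obtain ⟨M, hM⟩ := hbound
  have hterm : ∀ k j, 0 ≤ (1 + κ) / 2 * (p j * ‖(S k).ybar j - (S k).y j‖ ^ 2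
      / (2 * effDual A (σ k) j)) := fun k j => by
    have := hp j; have := hs' k j; positivity
  have hterm' : ∀ k j, 0 ≤ ‖(S k).y j - d₀.2 j‖ ^ 2 / (2 * effDual A (σ k) j * p j) := fun k j => by
    have := hp j; have := hs' k j; positivity
  have hxb : ∀ d : X × ∀ i, Y i, ∃ C, ∀ k, ‖(S k).x - d.1‖ ≤ C := by
    obtain ⟨C, hC⟩ := exists_norm_le_of_mul_norm_sq_le (v := fun k => (S k).x - d₀.1) (M := M)
      hT ha ha_pos fun k => by
        refine le_trans ?_ (hM k)
        rw [ha_def, one_div_mul_eq_div]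
        exact le_add_of_nonneg_right (Finset.sum_nonneg fun j _ =>
          add_nonneg (hterm' k j) (hterm k j))
    refine fun d => ⟨C + ‖d₀.1 - d.1‖, fun k => ?_⟩
    rw [← sub_add_sub_cancel _ d₀.1]
    exact (norm_add_le _ _).trans (add_le_add_left (hC k) _)
  have hyb : ∀ i, ∃ C, ∀ k, ‖(S k).y i‖ ≤ C := by
    intro i
    obtain ⟨C, hC⟩ := exists_norm_le_of_mul_norm_sq_le (v := fun k => (S k).y i - d₀.2 i) (M := M)
      (div_pos (hR i) (hp i)) (hb i) (fun k => hb_pos k i) fun k => by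
        refine le_trans ?_ (hM k)
        rw [hb_def, one_div_mul_eq_div]
        refine le_trans ?_ (le_add_of_nonneg_left (by have := ht' k; positivity))
        refine le_trans (le_add_of_nonneg_right (hterm k i)) ?_
        exact Finset.single_le_sum (f := fun j =>
          ‖(S k).y j - d₀.2 j‖ ^ 2 / (2 * effDual A (σ k) j * p j) + (1 + κ) / 2 *
            (p j * ‖(S k).ybar j - (S k).y j‖ ^ 2 / (2 * effDual A (σ k) j)))
          (fun j _ => add_nonneg (hterm' k j) (hterm k j)) (Finset.mem_univ i)
    refine ⟨C + ‖d₀.2 i‖, fun k => ?_⟩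
    calc ‖(S k).y i‖ = ‖((S k).y i - d₀.2 i) + d₀.2 i‖ := by rw [sub_add_cancel]
      _ ≤ _ := (norm_add_le _ _).trans (add_le_add_left (hC k) _)
  obtain ⟨Cx, hCx⟩ := hxb 0
  choose Cy hCy using hyb
  have hCy0 : ∀ i, 0 ≤ Cy i := fun i => (norm_nonneg _).trans (hCy i 0)
  have hCx0 : 0 ≤ Cx := (norm_nonneg _).trans (hCx 0)
  refine exists_weak_limit_mem_saddlePoints (C := Cx + ∑ i, Cy i) hf hg hc hcτ hcσ (fun k => ?_)
    (fun k i => ?_) hdx hdy he hT (fun i => div_pos (hR i) (hp i)) ha hb hDC fun d hd => ?_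
  · have h1 := hCx k
    simp only [Prod.fst_zero, sub_zero] at h1
    linarith [Finset.sum_nonneg fun i (_ : i ∈ Finset.univ) => hCy0 i]
  · linarith [hCy i k, Finset.single_le_sum (fun i _ => hCy0 i) (Finset.mem_univ i)]
  · obtain ⟨L, hL⟩ := hD d hd
    obtain ⟨C, hC⟩ := hxb d
    have h1 : ∀ j, Tendsto (fun k => ⟪A j ((S k).x - d.1), (S k).ybar j - (S k).y j⟫_ℝ)
        atTop (𝓝 0) := fun j =>
      tendsto_inner_zero_of_bounded (C := ‖A j‖ * C)
        (fun k => ((A j).le_opNorm _).trans (by gcongr; exact hC k)) (he j)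
    have h2 : ∀ j, Tendsto (fun k => (1 + κ) / 2 * (p j * (q k j *
        ‖(S k).ybar j - (S k).y j‖ ^ 2))) atTop (𝓝 0) := by
      intro j
      simpa using (((hq j).mul ((he j).norm.pow 2)).const_mul (p j)).const_mul ((1 + κ) / 2)
    -- Removing the vanishing cross and extrapolation terms from `lyap` leaves the weighted squared
    -- distance.
    have h3 := hL.sub (tendsto_finsetSum Finset.univ fun j _ => (h2 j).sub (h1 j))
    refine ⟨_, h3.congr fun k => ?_⟩
    simp only [lyap, Finset.sum_add_distrib, Finset.sum_sub_distrib, ha_def, hb_def, hq_def,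
      one_div_mul_eq_div, mul_div_assoc]
    ring

end PathConvergence

/-! ### Weak convergence in the product space. -/

section WeakSpaceProduct

theorem tendsto_toWeakSpace_of_forall {ι E : Type*} [NormedAddCommGroup E] [NormedSpace ℝ E]
    {l : Filter ι} {u : ι → E} {u' : E}
    (h : ∀ φ : E →L[ℝ] ℝ, Tendsto (fun k => φ (u k)) l (𝓝 (φ u'))) :
    Tendsto (fun k => toWeakSpace ℝ E (u k)) l (𝓝 (toWeakSpace ℝ E u')) := by
  have hind : IsInducing fun (x : WeakSpace ℝ E) (φ : E →L[ℝ] ℝ) =>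
      (topDualPairing ℝ E).flip x φ := ⟨rfl⟩
  rw [hind.tendsto_nhds_iff, tendsto_pi_nhds]
  exact h

variable {n : ℕ} {X : Type*} {Y : Fin n → Type*}
  [NormedAddCommGroup X] [InnerProductSpace ℝ X] [CompleteSpace X]
  [∀ i, NormedAddCommGroup (Y i)] [∀ i, InnerProductSpace ℝ (Y i)] [∀ i, CompleteSpace (Y i)]

/-- The product carries a sup norm and is no inner product space, so a functional is split over the
factors and Riesz is applied to each. -/
theorem tendsto_toWeakSpace_of_tendstoWeakly {ι : Type*} {l : Filter ι} {u : ι → X × ∀ i, Y i}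
    {z : X × ∀ i, Y i} (hx : TendstoWeakly (fun k => (u k).1) l z.1)
    (hy : ∀ i, TendstoWeakly (fun k => (u k).2 i) l (z.2 i)) :
    Tendsto (fun k => toWeakSpace ℝ (X × ∀ i, Y i) (u k)) l
      (𝓝 (toWeakSpace ℝ (X × ∀ i, Y i) z)) := by
  refine tendsto_toWeakSpace_of_forall fun φ => ?_
  set ψ : X →L[ℝ] ℝ := φ.comp (ContinuousLinearMap.inl ℝ X (∀ i, Y i))
  set χ : ∀ i, Y i →L[ℝ] ℝ := fun i =>
    φ.comp ((ContinuousLinearMap.inr ℝ X (∀ i, Y i)).comp (ContinuousLinearMap.single ℝ Y i))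
  have hsplit : ∀ w : X × ∀ i, Y i, φ w = ⟪(InnerProductSpace.toDual ℝ X).symm ψ, w.1⟫_ℝ
      + ∑ i, ⟪(InnerProductSpace.toDual ℝ (Y i)).symm (χ i), w.2 i⟫_ℝ := by
    intro w
    simp only [InnerProductSpace.toDual_symm_apply]
    have h1 : w = ContinuousLinearMap.inl ℝ X (∀ i, Y i) w.1
        + ContinuousLinearMap.inr ℝ X (∀ i, Y i) (∑ i, Pi.single i (w.2 i)) := by
      simp [Finset.univ_sum_single]
    conv_lhs => rw [h1]
    rw [map_add, map_sum, map_sum]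
    rfl
  simp only [hsplit]
  exact (hx _).add (tendsto_finsetSum Finset.univ fun i _ => hy i _)

end WeakSpaceProduct

/-! ### Measurability of weak limits. -/

section Measurability

variable {H : Type*} [NormedAddCommGroup H] [InnerProductSpace ℝ H]

theorem _root_.Orthonormal.countable_of_separable [TopologicalSpace.SeparableSpace H] {w : Set H}
    (hw : Orthonormal ℝ ((↑) : w → H)) : w.Countable := by
  have hd : w.PairwiseDisjoint fun e => Metric.ball e (1 / 2) := by
    intro e he e' he' hne
    refine Metric.ball_disjoint_ball ?_
    have h1 : ‖e - e'‖ ^ 2 = 2 := by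
      have h2 : ⟪e, e'⟫_ℝ = 0 := hw.2 (i := ⟨e, he⟩) (j := ⟨e', he'⟩) (by simpa using hne)
      have h3 : ‖e‖ = 1 := hw.1 ⟨e, he⟩
      have h4 : ‖e'‖ = 1 := hw.1 ⟨e', he'⟩
      rw [norm_sub_sq_real, h2, h3, h4]
      norm_num
    rw [dist_eq_norm]
    nlinarith [norm_nonneg (e - e')]
  exact hd.countable_of_isOpen (fun _ _ => Metric.isOpen_ball)
    fun e _ => ⟨e, Metric.mem_ball_self (by norm_num)⟩

/-- The coordinates in a Hilbert basis are almost sure limits of measurable functions, and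
separability makes the basis countable, so the expansion preserves measurability. -/
theorem aemeasurable_of_tendstoWeakly [CompleteSpace H] [TopologicalSpace.SeparableSpace H]
    [MeasurableSpace H] [BorelSpace H] {Ω : Type*} {m₀ : MeasurableSpace Ω} {μ : Measure Ω}
    {u : ℕ → Ω → H} (hu : ∀ k, Measurable (u k)) {w : Ω → H}
    (hw : ∀ᵐ ω ∂μ, TendstoWeakly (fun k => u k ω) atTop (w ω)) : AEMeasurable w μ := by
  obtain ⟨B, b, hb⟩ := exists_hilbertBasis ℝ H
  have hB : B.Countable := Orthonormal.countable_of_separable (hb ▸ b.orthonormal)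
  have : Countable B := hB.to_subtype
  have : SecondCountableTopology H := UniformSpace.secondCountable_of_separable H
  have hin : ∀ i, AEMeasurable (fun ω => b.repr (w ω) i • b i) μ := by
    intro i
    simp only [b.repr_apply_apply]
    refine AEMeasurable.smul_const ?_ _
    refine aemeasurable_of_tendsto_metrizable_ae atTop (f := fun k ω => ⟪b i, u k ω⟫_ℝ)
      (fun k => (measurable_const.inner (hu k)).aemeasurable) ?_
    filter_upwards [hw] with ω hω
    exact hω (b i)
  refine aemeasurable_of_tendsto_metrizable_ae atTop
    (f := fun (s : Finset B) ω => ∑ i ∈ s, b.repr (w ω) i • b i)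
    (fun s => Finset.aemeasurable_fun_sum s fun i _ => hin i) ?_
  exact Eventually.of_forall fun ω => b.hasSum_repr (w ω)

end Measurability

/-! ### The random algorithm. -/

section Main

variable {n : ℕ} {X : Type*} {Y : Fin n → Type*}
  [NormedAddCommGroup X] [InnerProductSpace ℝ X] [CompleteSpace X]
  [∀ i, NormedAddCommGroup (Y i)] [∀ i, InnerProductSpace ℝ (Y i)] [∀ i, CompleteSpace (Y i)]
  {A : ∀ i, X →L[ℝ] Y i} {f : ∀ i, Y i → EReal} {g : X → EReal} {p : Fin n → ℝ}
  {x0 : X} {y0 : ∀ i, Y i} {Ω : Type*} {τ : ℕ → Ω → ℝ} {σ : Fin n → ℕ → Ω → ℝ} {I : ℕ → Ω → Fin n}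

/-- The random state of the algorithm. -/
noncomputable def randomRun (A : ∀ i, X →L[ℝ] Y i) (f : ∀ i, Y i → EReal) (g : X → EReal)
    (p : Fin n → ℝ) (x0 : X) (y0 : ∀ i, Y i) (τ : ℕ → Ω → ℝ) (σ : Fin n → ℕ → Ω → ℝ)
    (I : ℕ → Ω → Fin n) (k : ℕ) (ω : Ω) : State X Y :=
  run A f g p x0 y0 (fun l => τ l ω) (fun i l => σ i l ω) (fun l => I l ω) k

theorem randomRun_succ (k : ℕ) (ω : Ω) :
    randomRun A f g p x0 y0 τ σ I (k + 1) ω = step A f g p (τ (k + 1) ω)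
      (fun i => σ i (k + 1) ω) (I k ω) (randomRun A f g p x0 y0 τ σ I k ω) := rfl

theorem exists_ybar_eq_y (k : ℕ) (ω : Ω) : ∃ i₀, ∀ j, j ≠ i₀ →
    (randomRun A f g p x0 y0 τ σ I k ω).ybar j = (randomRun A f g p x0 y0 τ σ I k ω).y j := by
  cases k with
  | zero => exact ⟨I 0 ω, fun j _ => rfl⟩
  | succ k =>
    refine ⟨I k ω, fun j hj => ?_⟩
    rw [← sub_eq_zero, randomRun_succ, step_ybar_sub_y, if_neg hj]

variable [MeasurableSpace X] [∀ i, MeasurableSpace (Y i)]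

/-- Strong induction is needed: the step-sizes of iteration `k` depend on all iterates up to `k`,
which in turn depend on the indices before `k`. -/
theorem dependsOnPast_randomRun
    (hτ : ∀ k, Measurable[history (iterate A f g p x0 y0 τ σ I) k] (τ (k + 1)))
    (hσ : ∀ i k, Measurable[history (iterate A f g p x0 y0 τ σ I) k] (σ i (k + 1))) (k : ℕ) :
    DependsOnPast I k (randomRun A f g p x0 y0 τ σ I k) := by
  induction k using Nat.strong_induction_on with
  | _ k ih =>
    cases k with
    | zero => exact fun _ _ _ => rfl
    | succ k =>
      have hit : ∀ l ≤ k, DependsOnPast I k (iterate A f g p x0 y0 τ σ I l) := by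
        intro l hl ω ω' h
        have h1 := ih l (Nat.lt_succ_of_le hl) ω ω' fun j hj => h j (hj.trans_le hl)
        change ((randomRun A f g p x0 y0 τ σ I l ω).x, (randomRun A f g p x0 y0 τ σ I l ω).y)
          = ((randomRun A f g p x0 y0 τ σ I l ω').x, (randomRun A f g p x0 y0 τ σ I l ω').y)
        rw [h1]
      intro ω ω' h
      have h' : ∀ l < k, I l ω = I l ω' := fun l hl => h l (hl.trans (Nat.lt_succ_self k))
      have h1 := dependsOnPast_of_measurable_history hit (hτ k) ω ω' h'
      have h2 : (fun i => σ i (k + 1) ω) = fun i => σ i (k + 1) ω' := funext fun i =>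
        dependsOnPast_of_measurable_history hit (hσ i k) ω ω' h'
      rw [randomRun_succ, randomRun_succ, ih k (Nat.lt_succ_self k) ω ω' h', h1, h2,
        h k (Nat.lt_succ_self k)]

theorem dependsOnPast_of_measurable_history_iterate
    (hS : ∀ k, DependsOnPast I k (randomRun A f g p x0 y0 τ σ I k)) {k : ℕ} {v : Ω → ℝ}
    (hv : Measurable[history (iterate A f g p x0 y0 τ σ I) k] v) : DependsOnPast I k v := by
  refine dependsOnPast_of_measurable_history (fun l hl ω ω' h => ?_) hv
  have h1 := (hS l).mono hl ω ω' h
  change ((randomRun A f g p x0 y0 τ σ I l ω).x, (randomRun A f g p x0 y0 τ σ I l ω).y)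
    = ((randomRun A f g p x0 y0 τ σ I l ω').x, (randomRun A f g p x0 y0 τ σ I l ω').y)
  rw [h1]

theorem ae_lyap_tendsto_and_summable_drift {m₀ : MeasurableSpace Ω} {μ : Measure Ω}
    [IsProbabilityMeasure μ] (hf : ∀ i, IsProperConvexLSC (f i)) (hg : IsProperConvexLSC g)
    (hp : ∀ i, 0 < p i) (hI : ∀ k, Measurable (I k)) (hIindep : iIndepFun I μ)
    (hIlaw : ∀ k i, μ {ω | I k ω = i} = ENNReal.ofReal (p i))
    (hτ : ∀ k, Measurable[history (iterate A f g p x0 y0 τ σ I) k] (τ (k + 1)))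
    (hσ : ∀ i k, Measurable[history (iterate A f g p x0 y0 τ σ I) k] (σ i (k + 1)))
    (hτpos : ∀ k ω, 0 < τ k ω) (hσpos : ∀ i k ω, 0 < σ i k ω) {κ : ℝ} (hκ : 0 ≤ κ) (hκ' : κ < 1)
    (hA : ∀ᵐ ω ∂μ, ∀ k i, ‖A i‖ ^ 2 * (effPrimal A (τ (k + 1) ω)
      * effDual A (fun i => σ i (k + 1) ω) i) ≤ κ ^ 2 * p i)
    {δ : ℕ → ℝ} (hδ : ∀ k, 0 ≤ δ k) (hδs : Summable δ)
    (hτδ : ∀ᵐ ω ∂μ, ∀ k, 1 / τ (k + 1 + 1) ω ≤ (1 + δ k) * (1 / τ (k + 1) ω))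
    (hσδ : ∀ᵐ ω ∂μ, ∀ k i, 1 / σ i (k + 1 + 1) ω ≤ (1 + δ k) * (1 / σ i (k + 1) ω))
    {d : X × ∀ i, Y i} (hd : d ∈ saddlePoints A f g) :
    ∀ᵐ ω ∂μ, (∃ L, Tendsto (fun k => lyap A p κ d (effPrimal A (τ (k + 1) ω))
        (effDual A fun i => σ i (k + 1) ω) (randomRun A f g p x0 y0 τ σ I k ω)) atTop (𝓝 L)) ∧
      Summable fun k => drift A f g κ (τ (k + 1) ω) (fun i => σ i (k + 1) ω)
        (randomRun A f g p x0 y0 τ σ I k ω) := by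
  set S := randomRun A f g p x0 y0 τ σ I
  have hp1 : ∑ i, p i = 1 := sum_eq_one_of_law (hI 0) hp (hIlaw 0)
  have hS : ∀ k, DependsOnPast I k (S k) := dependsOnPast_randomRun hτ hσ
  have hτ' : ∀ k, DependsOnPast I k (τ (k + 1)) := fun k =>
    dependsOnPast_of_measurable_history_iterate hS (hτ k)
  have hσ' : ∀ k ω ω', (∀ l < k, I l ω = I l ω') →
      (fun i => σ i (k + 1) ω) = fun i => σ i (k + 1) ω' := fun k ω ω' h => funext fun i =>
    dependsOnPast_of_measurable_history_iterate hS (hσ i k) ω ω' h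
  set V : ℕ → Ω → ℝ := fun k ω => lyap A p κ d (effPrimal A (τ (k + 1) ω))
    (effDual A fun i => σ i (k + 1) ω) (S k ω) with hV
  set D : ℕ → Ω → ℝ := fun k ω => drift A f g κ (τ (k + 1) ω) (fun i => σ i (k + 1) ω) (S k ω)
    with hD
  have hVp : ∀ k, DependsOnPast I k (V k) := fun k ω ω' h => by
    simp only [hV]
    rw [hτ' k ω ω' h, hS k ω ω' h, hσ' k ω ω' h]
  have hDp : ∀ k, DependsOnPast I k (D k) := fun k ω ω' h => by
    simp only [hD]
    rw [hτ' k ω ω' h, hS k ω ω' h, hσ' k ω ω' h]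
  have hDnonneg : ∀ k ω, 0 ≤ D k ω := fun k ω =>
    drift_nonneg hκ' (hτpos _ _) (fun i => hσpos i _ _) _
  have hκ1 : 0 < 1 - κ := by linarith
  have hε : ∀ k, 0 ≤ 2 * δ k / (1 - κ) := fun k => by have := hδ k; positivity
  refine ae_tendsto_and_summable_of_condExp_le (ℱ := pastFiltration I hI)
    (ε := fun k => 2 * δ k / (1 - κ))
    (fun k => ((hVp k).measurable hI).stronglyMeasurable)
    (fun k => ((hDp k).measurable hI).stronglyMeasurable)
    (fun k => (hVp k).integrable hI) (fun k => (hDp k).integrable hI) ?_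
    (Eventually.of_forall fun ω k => hDnonneg k ω) hε ((hδs.mul_left 2).div_const _) fun k => ?_
  · filter_upwards [hA] with ω hω k
    obtain ⟨i₀, hi₀⟩ := exists_ybar_eq_y (A := A) (f := f) (g := g) (p := p) (x0 := x0) (y0 := y0)
      (τ := τ) (σ := σ) (I := I) k ω
    exact lyap_nonneg hκ hκ' (effPrimal_pos A (hτpos _ _)) (effDual_pos A fun i => hσpos i _ _) hp
      (hω k) d hi₀
  · set φ : Fin n → Ω → ℝ := fun i ω => lyap A p κ d (effPrimal A (τ (k + 1) ω))
      (effDual A fun i => σ i (k + 1) ω) (step A f g p (τ (k + 1) ω)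
        (fun i => σ i (k + 1) ω) i (S k ω)) with hφ
    have hφp : ∀ i, DependsOnPast I k (φ i) := fun i ω ω' h => by
      simp only [hφ]
      rw [hτ' k ω ω' h, hS k ω ω' h, hσ' k ω ω' h]
    have hφI : DependsOnPast I (k + 1) fun ω => φ (I k ω) ω := fun ω ω' h => by
      simp only
      rw [h k (Nat.lt_succ_self k), (hφp _).mono (Nat.le_succ k) ω ω' h]
    -- `φ (I k)` is `lyap` at the new state with the old step-sizes, which are known at time `k`.
    -- The change of step-sizes is paid for here, before conditioning.
    have hle : V (k + 1) ≤ᵐ[μ] (1 + 2 * δ k / (1 - κ)) • fun ω => φ (I k ω) ω := by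
      filter_upwards [hA, hτδ, hσδ] with ω h1 h2 h3
      obtain ⟨i₀, hi₀⟩ := exists_ybar_eq_y (A := A) (f := f) (g := g) (p := p) (x0 := x0)
        (y0 := y0) (τ := τ) (σ := σ) (I := I) (k + 1) ω
      exact lyap_le_mul_lyap hκ hκ' (effPrimal_pos A (hτpos _ _))
        (effDual_pos A fun i => hσpos i _ _) hp (h1 k) (hδ k)
        (one_div_effPrimal_le A (hδ k) (h2 k)) (one_div_effDual_le A (hδ k) (h3 k)) d hi₀
    have hmono := condExp_mono (m := pastFiltration I hI k) ((hVp (k + 1)).integrable hI)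
      ((hφI.integrable hI).smul (1 + 2 * δ k / (1 - κ))) hle
    filter_upwards [hmono, condExp_smul (1 + 2 * δ k / (1 - κ)) (fun ω => φ (I k ω) ω)
      (pastFiltration I hI k) (μ := μ), condExp_apply_index hI hIindep hp hIlaw hφp, hA]
      with ω h1 h2 h3 h4
    rw [h2, Pi.smul_apply, h3, smul_eq_mul] at h1
    obtain ⟨i₀, hi₀⟩ := exists_ybar_eq_y (A := A) (f := f) (g := g) (p := p) (x0 := x0) (y0 := y0)
      (τ := τ) (σ := σ) (I := I) k ω
    have h5 : ∑ i, p i * φ i ω ≤ V k ω - D k ω :=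
      sum_mul_lyap_step_le hf hg hd hκ hκ' (hτpos _ _) (fun i => hσpos i _ _) hp hp1 (h4 k) hi₀
    have h6 := mul_nonneg (hε k) (hDnonneg k ω)
    calc _ ≤ _ := h1
      _ ≤ (1 + 2 * δ k / (1 - κ)) * (V k ω - D k ω) :=
        mul_le_mul_of_nonneg_left h5 (by linarith [hε k])
      _ ≤ _ := by linarith

end Main

end ASPDHG

/-! ### Assembly of the theorem. -/

theorem mainTheorem1 {n : ℕ} {X : Type*} {Y : Fin n → Type*}
    [NormedAddCommGroup X] [InnerProductSpace ℝ X] [CompleteSpace X]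
    [TopologicalSpace.SeparableSpace X] [MeasurableSpace X] [BorelSpace X]
    [∀ i, NormedAddCommGroup (Y i)] [∀ i, InnerProductSpace ℝ (Y i)] [∀ i, CompleteSpace (Y i)]
    [∀ i, TopologicalSpace.SeparableSpace (Y i)] [∀ i, MeasurableSpace (Y i)]
    [∀ i, BorelSpace (Y i)]
    {Ω : Type*} [MeasurableSpace Ω] (μ : Measure Ω) [IsProbabilityMeasure μ]
    -- the problem
    (A : ∀ i, X →L[ℝ] Y i) (f : ∀ i, Y i → EReal) (g : X → EReal)
    (hf : ∀ i, ASPDHG.IsProperConvexLSC (f i)) (hg : ASPDHG.IsProperConvexLSC g)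
    (hC : (ASPDHG.saddlePoints A f g).Nonempty)
    -- the sampling: independent indices, equal to `i` with probability `p i > 0`
    (p : Fin n → ℝ) (hp : ∀ i, 0 < p i)
    (I : ℕ → Ω → Fin n) (hI : ∀ k, Measurable (I k)) (hIindep : iIndepFun I μ)
    (hIlaw : ∀ k i, μ {ω | I k ω = i} = ENNReal.ofReal (p i))
    -- the starting point and the step-sizes
    (x0 : X) (y0 : ∀ i, Y i) (τ : ℕ → Ω → ℝ) (σ : Fin n → ℕ → Ω → ℝ)
    -- (i) the step-sizes of index `k + 1` are measurable with respect to the first `k` iterates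
    (hτ : ∀ k, Measurable[ASPDHG.history (ASPDHG.iterate A f g p x0 y0 τ σ I) k] (τ (k + 1)))
    (hσ : ∀ i k, Measurable[ASPDHG.history (ASPDHG.iterate A f g p x0 y0 τ σ I) k] (σ i (k + 1)))
    -- (ii) the uniform bound on the products of the step-sizes
    (hβ : ∃ β : ℝ, 0 < β ∧ β < 1 ∧
      ∀ᵐ ω ∂μ, ∀ k i, τ k ω * σ i k ω * (‖A i‖ ^ 2 / p i) ≤ β)
    -- (iii) the step-sizes are positive and uniformly almost surely quasi-increasing
    (hτqi : ASPDHG.UniformlyQuasiIncreasing μ τ)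
    (hσqi : ∀ i, ASPDHG.UniformlyQuasiIncreasing μ (σ i)) :
    -- almost sure weak convergence to a random saddle point
    ∃ z : Ω → X × (∀ i, Y i), Measurable z ∧
      ∀ᵐ ω ∂μ, z ω ∈ ASPDHG.saddlePoints A f g ∧
        Tendsto
          (fun k => toWeakSpace ℝ (X × ∀ i, Y i) (ASPDHG.iterate A f g p x0 y0 τ σ I k ω))
          atTop (𝓝 (toWeakSpace ℝ (X × ∀ i, Y i) (z ω))) := by
  obtain ⟨β, hβ0, hβ1, hβ⟩ := hβ
  obtain ⟨δ₀, hδ₀, hδ₀s, hτδ₀⟩ := hτqi.exists_one_div_le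
  choose δ₁ hδ₁ hδ₁s hσδ₁ using fun i => (hσqi i).exists_one_div_le
  -- One control for all step-sizes, shifted because state `k` is paired with the step-sizes of
  -- index `k + 1`; those of index `0` are never used.
  set δ : ℕ → ℝ := fun k => δ₀ (k + 1) + ∑ i, δ₁ i (k + 1)
  have hsum : ∀ k, 0 ≤ ∑ i, δ₁ i (k + 1) := fun k => Finset.sum_nonneg fun i _ => hδ₁ i _
  have hδ : ∀ k, 0 ≤ δ k := fun k => add_nonneg (hδ₀ _) (hsum k)
  have hδs : Summable δ := ((summable_nat_add_iff 1).2 hδ₀s).add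
    (summable_sum fun i _ => (summable_nat_add_iff 1).2 (hδ₁s i))
  have hτpos := hτqi.1
  have hσpos := fun i => (hσqi i).1
  have hτδ : ∀ᵐ ω ∂μ, ∀ k, 1 / τ (k + 1 + 1) ω ≤ (1 + δ k) * (1 / τ (k + 1) ω) := by
    filter_upwards [hτδ₀] with ω hω k
    have := hτpos (k + 1) ω
    refine (hω (k + 1)).trans (mul_le_mul_of_nonneg_right ?_ (by positivity))
    linarith [hsum k]
  have hσδ : ∀ᵐ ω ∂μ, ∀ k i, 1 / σ i (k + 1 + 1) ω ≤ (1 + δ k) * (1 / σ i (k + 1) ω) := by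
    filter_upwards [ae_all_iff.2 hσδ₁] with ω hω k i
    have := hσpos i (k + 1) ω
    refine (hω i (k + 1)).trans (mul_le_mul_of_nonneg_right ?_ (by positivity))
    have h1 : δ₁ i (k + 1) ≤ ∑ i, δ₁ i (k + 1) :=
      Finset.single_le_sum (f := fun i => δ₁ i (k + 1)) (fun i _ => hδ₁ i _) (Finset.mem_univ i)
    linarith [hδ₀ (k + 1)]
  have hκ : 0 ≤ √β := Real.sqrt_nonneg β
  have hκ' : √β < 1 := by rw [Real.sqrt_lt' one_pos]; simpa using hβ1
  have hA : ∀ᵐ ω ∂μ, ∀ k i, ‖A i‖ ^ 2 * (ASPDHG.effPrimal A (τ (k + 1) ω)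
      * ASPDHG.effDual A (fun i => σ i (k + 1) ω) i) ≤ √β ^ 2 * p i := by
    filter_upwards [hβ] with ω hω k i
    rw [Real.sq_sqrt hβ0.le]
    exact ASPDHG.effPrimal_mul_effDual_le hβ0.le hp (hω (k + 1)) i
  -- Countability of `D` allows a single null set for all its points.
  obtain ⟨D, hDsub, hDcount, hDC⟩ := (TopologicalSpace.IsSeparable.of_separableSpace
    (ASPDHG.saddlePoints A f g)).exists_countable_dense_subset
  have hDne : D.Nonempty := closure_nonempty_iff.1 (hC.mono hDC)
  have hae := (ae_ball_iff hDcount).2 fun d hd =>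
    ASPDHG.ae_lyap_tendsto_and_summable_drift hf hg hp hI hIindep hIlaw hτ hσ hτpos hσpos hκ hκ'
      hA hδ hδs hτδ hσδ (hDsub hd)
  have hlim : ∀ᵐ ω ∂μ, ∃ z ∈ ASPDHG.saddlePoints A f g,
      ASPDHG.TendstoWeakly (fun k => (ASPDHG.iterate A f g p x0 y0 τ σ I k ω).1) atTop z.1 ∧
      ∀ i, ASPDHG.TendstoWeakly (fun k => (ASPDHG.iterate A f g p x0 y0 τ σ I k ω).2 i) atTop
        (z.2 i) := by
    filter_upwards [hae, hA, hτδ, hσδ] with ω h1 h2 h3 h4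
    exact ASPDHG.exists_weak_limit_of_lyap_tendsto (I := fun k => I k ω)
      (S := fun k => ASPDHG.randomRun A f g p x0 y0 τ σ I k ω) hf hg hp hκ hκ'
      (fun k => ASPDHG.randomRun_succ k ω) (fun k => hτpos (k + 1) ω)
      (fun k i => hσpos i (k + 1) ω) h2 (fun k => ASPDHG.exists_ybar_eq_y k ω) hδ hδs h3 h4
      hDne hDC (fun d hd => (h1 d hd).1) (h1 _ hDne.some_mem).2
  have hS := ASPDHG.dependsOnPast_randomRun hτ hσ
  classical
  -- Chosen pointwise, with default `0`, so with no measurability a priori; it is almost everywhere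
  -- measurable as a weak limit and is replaced at the end by a measurable version.
  set z : Ω → X × ∀ i, Y i := fun ω => if h : ∃ z ∈ ASPDHG.saddlePoints A f g,
      ASPDHG.TendstoWeakly (fun k => (ASPDHG.iterate A f g p x0 y0 τ σ I k ω).1) atTop z.1 ∧
      ∀ i, ASPDHG.TendstoWeakly (fun k => (ASPDHG.iterate A f g p x0 y0 τ σ I k ω).2 i) atTop
        (z.2 i) then h.choose else 0 with hz
  have hzspec : ∀ᵐ ω ∂μ, z ω ∈ ASPDHG.saddlePoints A f g ∧
      ASPDHG.TendstoWeakly (fun k => (ASPDHG.iterate A f g p x0 y0 τ σ I k ω).1) atTop (z ω).1 ∧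
      ∀ i, ASPDHG.TendstoWeakly (fun k => (ASPDHG.iterate A f g p x0 y0 τ σ I k ω).2 i) atTop
        ((z ω).2 i) := by
    filter_upwards [hlim] with ω hω
    simp only [hz]
    rw [dif_pos hω]
    exact hω.choose_spec
  have hzx : AEMeasurable (fun ω => (z ω).1) μ := by
    refine ASPDHG.aemeasurable_of_tendstoWeakly
      (u := fun k ω => (ASPDHG.iterate A f g p x0 y0 τ σ I k ω).1) (fun k => ?_)
      (hzspec.mono fun ω h => h.2.1)
    have h1 : ASPDHG.DependsOnPast I k fun ω => (ASPDHG.iterate A f g p x0 y0 τ σ I k ω).1 :=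
      fun ω ω' h => congrArg ASPDHG.State.x (hS k ω ω' h)
    exact (h1.measurable hI).mono ((ASPDHG.pastFiltration I hI).le k) le_rfl
  have hzy : ∀ i, AEMeasurable (fun ω => (z ω).2 i) μ := by
    intro i
    refine ASPDHG.aemeasurable_of_tendstoWeakly
      (u := fun k ω => (ASPDHG.iterate A f g p x0 y0 τ σ I k ω).2 i) (fun k => ?_)
      (hzspec.mono fun ω h => h.2.2 i)
    have h1 : ASPDHG.DependsOnPast I k fun ω => (ASPDHG.iterate A f g p x0 y0 τ σ I k ω).2 i :=
      fun ω ω' h => congrArg (fun T => ASPDHG.State.y T i) (hS k ω ω' h)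
    exact (h1.measurable hI).mono ((ASPDHG.pastFiltration I hI).le k) le_rfl
  have hzm : AEMeasurable z μ := hzx.prodMk (aemeasurable_pi_lambda _ hzy)
  refine ⟨hzm.mk z, hzm.measurable_mk, ?_⟩
  filter_upwards [hzspec, hzm.ae_eq_mk] with ω h1 h2
  rw [← h2]
  exact ⟨h1.1, ASPDHG.tendsto_toWeakSpace_of_tendstoWeakly h1.2.1 h1.2.2⟩
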